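/- **Proposition (IDS of the $(6^3)$ honeycomb tiling).** Let $G=(\mathcal V,\mathcal E)$ be the graph of the honeycomb tiling of the plane by regular hexagons: with $a=(0,1)$, $b=(0,0)$, $\omega_1=(\tfrac{\sqrt3}{2},\tfrac32)$, $\omega_2=(-\tfrac{\sqrt3}{2},\tfrac32)$, its vertices are the points $a+\gamma_1\omega_1+\gamma_2\omega_2$ and $b+\gamma_1\omega_1+\gamma_2\omega_2$, $\gamma\in\mathbb Z^2$, two vertices being adjacent iff their distance is $1$ (so every vertex has degree $3$). Let $\Delta$ be the bounded self-adjoint operator $$(\Delta f)(v)=f(v)-\frac1{|v|}\sum_{w\sim v}f(w)\qquad\text{on }\ell^2(\mathcal V),$$ where $|v|$ is the degree of $v$, let $Q=\{a,b\}$ (a fundamental domain for the translations by $\mathbb Z\omega_1+\mathbb Z\omega_2$), and let $$N(E)=\frac1{|Q|}\operatorname{Tr}\bigl(\chi_Q\,\chi_{(-\infty,E]}(\Delta)\bigr),\qquad E\in\mathbb R,$$ be the integrated density of states (IDS), where $\chi_{(-\infty,E]}(\Delta)$ is the spectral projector of $\Delta$ onto $(-\infty,E]$. Put $$g_E(t)=\frac{\arccos\left(\frac{9(1-E)^2-1}{4t}-t\right)}{\sqrt{1-t^2}}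 .$$ Then $$N(E)=\begin{cases} 0 & \text{if } E<0,\\[2pt] \dfrac1{\pi^2}\displaystyle\int_{1-\frac32E}^{1} g_E(t)\,dt & \text{if } 0\le E<\tfrac23,\\[6pt] \dfrac12-\dfrac1{\pi^2}\displaystyle\int_{-2+\frac32E}^{1-\frac32E} g_E(t)\,dt & \text{if } \tfrac23\le E<1,\\[6pt] \dfrac12+\dfrac1{\pi^2}\displaystyle\int_{1-\frac32E}^{-2+\frac32E} g_E(t)\,dt & \text{if } 1\le E<\tfrac43,\\[6pt] 1-\dfrac1{\pi^2}\displaystyle\int_{-2+\frac32E}^{1} g_E(t)\,dt & \text{if } \tfrac43\le E<2,\\[6pt] 1 & \text{if } 2\le E, \end{cases}$$ where all the integrals converge absolutely. Moreover $N$ is antisymmetric about $(1,\tfrac12)$, that is, $N(2-E)=1-N(E)$ for all $E\in\mathbb R$, and $\Delta$ has no $\ell^2$-eigenfunctions: no $z\in\mathbb C$ is an eigenvalue of $\Delta$ on $\ell^2(\mathcal V)$. -/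

import Mathlib

open MeasureTheory
open scoped InnerProductSpace

noncomputable section

namespace PeriodicGraph

/-! ### The Laplacian of a regular graph on `ℓ²(V)` -/

/-- The complex Hilbert space `ℓ²(V)`. -/
abbrev EllTwo (V : Type*) : Type _ := lp (fun _ : V => ℂ) 2

section Laplacian

variable {V : Type*} (G : SimpleGraph V) [G.LocallyFinite]

theorem sum_sq_neighbor_le {d : ℕ} (hG : G.IsRegularOfDegree d) (f : EllTwo V) (s : Finset V) :
    ∑ v ∈ s, ‖∑ w ∈ G.neighborFinset v, f w‖ ^ (2 : ENNReal).toReal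
      ≤ ((d : ℝ) * ‖f‖) ^ (2 : ENNReal).toReal := by
  classical
  have h1 : ∀ v ∈ s, ‖∑ w ∈ G.neighborFinset v, f w‖ ^ (2 : ENNReal).toReal
      ≤ (d : ℝ) * ∑ w ∈ G.neighborFinset v, ‖f w‖ ^ 2 := by
    intro v _
    have hc : ((G.neighborFinset v).card : ℝ) = d := by
      rw [G.card_neighborFinset_eq_degree, hG.degree_eq v]
    calc ‖∑ w ∈ G.neighborFinset v, f w‖ ^ (2 : ENNReal).toReal
        = ‖∑ w ∈ G.neighborFinset v, f w‖ ^ 2 := by simp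
      _ ≤ (∑ w ∈ G.neighborFinset v, ‖f w‖) ^ 2 := by
          gcongr; exact norm_sum_le _ _
      _ ≤ (d : ℝ) * ∑ w ∈ G.neighborFinset v, ‖f w‖ ^ 2 := by
          rw [← hc]; exact sq_sum_le_card_mul_sum_sq
  set t : Finset V := s.biUnion fun v => G.neighborFinset v with ht
  have h2 : ∑ v ∈ s, ∑ w ∈ G.neighborFinset v, ‖f w‖ ^ 2 ≤ (d : ℝ) * ∑ w ∈ t, ‖f w‖ ^ 2 := by
    have h3 : ∑ v ∈ s, ∑ w ∈ G.neighborFinset v, ‖f w‖ ^ 2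
        = ∑ w ∈ t, ∑ v ∈ s.filter (fun v => w ∈ G.neighborFinset v), ‖f w‖ ^ 2 := by
      apply Finset.sum_comm'
      intro v w
      simp only [ht, Finset.mem_biUnion, Finset.mem_filter]
      constructor
      · rintro ⟨h, h'⟩
        exact ⟨⟨h, h'⟩, v, h, h'⟩
      · rintro ⟨h, _⟩
        exact h
    rw [h3, Finset.mul_sum]
    refine Finset.sum_le_sum fun w _ => ?_
    rw [Finset.sum_const, nsmul_eq_mul]
    gcongr
    rw [← hG.degree_eq w, ← G.card_neighborFinset_eq_degree]
    refine Finset.card_le_card fun v hv => ?_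
    simp only [Finset.mem_filter, SimpleGraph.mem_neighborFinset] at hv ⊢
    exact hv.2.symm
  have h4 : ∑ w ∈ t, ‖f w‖ ^ 2 ≤ ‖f‖ ^ 2 := by
    have := lp.sum_rpow_le_norm_rpow (p := 2) (by norm_num) f t
    simpa using this
  calc ∑ v ∈ s, ‖∑ w ∈ G.neighborFinset v, f w‖ ^ (2 : ENNReal).toReal
      ≤ ∑ v ∈ s, (d : ℝ) * ∑ w ∈ G.neighborFinset v, ‖f w‖ ^ 2 := Finset.sum_le_sum h1
    _ = (d : ℝ) * ∑ v ∈ s, ∑ w ∈ G.neighborFinset v, ‖f w‖ ^ 2 := by rw [Finset.mul_sum]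
    _ ≤ (d : ℝ) * ((d : ℝ) * ‖f‖ ^ 2) := by gcongr; exact h2.trans (by gcongr)
    _ = ((d : ℝ) * ‖f‖) ^ (2 : ENNReal).toReal := by simp; ring

/-- The adjacency operator `(A f)(v) = ∑_{w ∼ v} f(w)` of a `d`-regular graph on `ℓ²(V)`. -/
def adjacencyOp {d : ℕ} (hG : G.IsRegularOfDegree d) : EllTwo V →L[ℂ] EllTwo V :=
  LinearMap.mkContinuous
    { toFun := fun f =>
        ⟨fun v => ∑ w ∈ G.neighborFinset v, f w, memℓp_gen' (sum_sq_neighbor_le G hG f)⟩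
      map_add' := fun f g => by
        ext v
        exact Finset.sum_add_distrib
      map_smul' := fun c f => by
        ext v
        exact (Finset.mul_sum _ _ _).symm }
    d
    (fun f => lp.norm_le_of_forall_sum_le (p := 2) (by norm_num) (by positivity)
      (sum_sq_neighbor_le G hG f))

theorem adjacencyOp_apply {d : ℕ} (hG : G.IsRegularOfDegree d) (f : EllTwo V) (v : V) :
    adjacencyOp G hG f v = ∑ w ∈ G.neighborFinset v, f w := rfl

/-- The graph Laplacian on `ℓ²(V)` (see `laplacian_apply` for its pointwise form). -/
def laplacian {d : ℕ} (hG : G.IsRegularOfDegree d) : EllTwo V →L[ℂ] EllTwo V :=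
  ContinuousLinearMap.id ℂ (EllTwo V) - ((d : ℂ)⁻¹) • adjacencyOp G hG

/-- `(Δ f)(v) = f(v) - (1 / |v|) ∑_{w ∼ v} f(w)`. -/
theorem laplacian_apply {d : ℕ} (hG : G.IsRegularOfDegree d) (f : EllTwo V) (v : V) :
    laplacian G hG f v
      = f v - (1 / (G.degree v : ℂ)) * ∑ w ∈ G.neighborFinset v, f w := by
  rw [hG.degree_eq v, one_div, ← adjacencyOp_apply G hG]
  rfl

end Laplacian

/-! ### Spectral projectors, traces, and the integrated density of states -/

/-- The canonical basis vector `δ_v` of `ℓ²(V)`. -/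
def delta {V : Type*} (v : V) : EllTwo V :=
  letI := Classical.decEq V
  lp.single 2 v 1

theorem inner_delta {V : Type*} (v : V) (f : EllTwo V) : ⟪delta v, f⟫_ℂ = f v := by
  classical
  unfold delta
  rw [lp.inner_single_left]
  simp

theorem laplacian_isSelfAdjoint {V : Type*} (G : SimpleGraph V) [G.LocallyFinite] {d : ℕ}
    (hG : G.IsRegularOfDegree d) : IsSelfAdjoint (laplacian G hG) := by
  classical
  have hδ : ∀ v w : V, (delta v : EllTwo V) w = if w = v then 1 else 0 := by
    intro v w
    unfold delta
    by_cases h : w = v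
    · subst h; simp
    · simp [h]
  have hAδ : ∀ v, adjacencyOp G hG (delta v) = ∑ w ∈ G.neighborFinset v, delta w := by
    intro v
    ext u
    rw [adjacencyOp_apply, lp.coeFn_sum, Finset.sum_apply]
    simp only [hδ, Finset.sum_ite_eq, Finset.sum_ite_eq', SimpleGraph.mem_neighborFinset,
      G.adj_comm]
  have hA : IsSelfAdjoint (adjacencyOp G hG) := by
    rw [ContinuousLinearMap.isSelfAdjoint_iff']
    ext f v
    rw [← inner_delta, ContinuousLinearMap.adjoint_inner_right, hAδ, sum_inner,
      adjacencyOp_apply]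
    simp only [inner_delta]
  unfold laplacian
  have h1 : IsSelfAdjoint (ContinuousLinearMap.id ℂ (EllTwo V)) :=
    IsSelfAdjoint.one (EllTwo V →L[ℂ] EllTwo V)
  refine h1.sub (IsSelfAdjoint.smul ?_ hA)
  simp [isSelfAdjoint_iff]

/-- The spectral projector `χ_{(-∞, E]}(T)` of a bounded self-adjoint operator `T`: the orthogonal
projection onto the kernel of the positive part `(T - E)₊`, the function `x ↦ (x - E)₊` being
continuous with zero set exactly `(-∞, E]`. -/
def spectralProjector {H : Type*} [NormedAddCommGroup H] [InnerProductSpace ℂ H] [CompleteSpace H]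
    (T : H →L[ℂ] H) (E : ℝ) : H →L[ℂ] H :=
  haveI : CompleteSpace (LinearMap.ker (cfc (fun x : ℝ => max (x - E) 0) T).toLinearMap) :=
    (cfc (fun x : ℝ => max (x - E) 0) T).isClosed_ker.completeSpace_coe
  (LinearMap.ker (cfc (fun x : ℝ => max (x - E) 0) T).toLinearMap).starProjection

/-- The operator `χ_Q` on `ℓ²(V)`, i.e. `∑_{v ∈ Q} |δ_v⟩⟨δ_v|`. -/
def cutoff {V : Type*} (Q : Finset V) : EllTwo V →L[ℂ] EllTwo V :=
  ∑ v ∈ Q, InnerProductSpace.rankOne ℂ (delta v) (delta v)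

/-- The trace `∑_v ⟨δ_v, T δ_v⟩` in the canonical basis of `ℓ²(V)` (used below only for operators
`T = χ_Q P` with `Q` finite, for which only finitely many terms are nonzero). -/
def trace {V : Type*} (T : EllTwo V →L[ℂ] EllTwo V) : ℂ :=
  ∑' v : V, ⟪delta v, T (delta v)⟫_ℂ

/-- The integrated density of states `N(E) = |Q|⁻¹ Tr (χ_Q χ_{(-∞, E]}(Δ))` of a regular graph,
for a finite fundamental domain `Q` of a cofinite group action. -/
def ids {V : Type*} (G : SimpleGraph V) [G.LocallyFinite] {d : ℕ} (hG : G.IsRegularOfDegree d)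
    (Q : Finset V) (E : ℝ) : ℝ :=
  (1 / (Q.card : ℝ)) * (trace (cutoff Q ∘L spectralProjector (laplacian G hG) E)).re

end PeriodicGraph

/-! ### The honeycomb tiling -/

/-- The vertices of the tiling of the plane by regular hexagons of side length one: `a γ` and `b γ`
are the translates of the points `a = (0, 1)` and `b = (0, 0)` by `γ₁ ω₁ + γ₂ ω₂`, where
`ω₁ = (√3 / 2, 3 / 2)` and `ω₂ = (-√3 / 2, 3 / 2)`. -/
inductive HoneycombVertex : Type
  | a (γ : ℤ × ℤ)
  | b (γ : ℤ × ℤ)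
  deriving DecidableEq

namespace HoneycombVertex

/-- The position of a vertex in the Euclidean plane. -/
def position : HoneycombVertex → EuclideanSpace ℝ (Fin 2)
  | a γ => !₂[(γ.1 - γ.2) * (√3 / 2), 1 + (γ.1 + γ.2) * (3 / 2)]
  | b γ => !₂[(γ.1 - γ.2) * (√3 / 2), (γ.1 + γ.2) * (3 / 2)]

/-- The `ℤ²`-action by translations. -/
def translate (γ : ℤ × ℤ) : HoneycombVertex → HoneycombVertex
  | a η => a (γ + η)
  | b η => b (γ + η)

/-- The fundamental domain `{a, b}` consisting of the points `(0, 1)` and `(0, 0)`. -/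
def fundamentalDomain : Finset HoneycombVertex := {a 0, b 0}

/-- The three neighbours of a vertex. -/
def neighbors : HoneycombVertex → Finset HoneycombVertex
  | a γ => {b γ, b (γ + (1, 0)), b (γ + (0, 1))}
  | b γ => {a γ, a (γ - (1, 0)), a (γ - (0, 1))}

end HoneycombVertex

open HoneycombVertex in
/-- The graph of the honeycomb tiling: `a + γ` is joined to `b + γ`, `b + γ + ω₁`, `b + γ + ω₂`. -/
def honeycomb : SimpleGraph HoneycombVertex where
  Adj v w := w ∈ v.neighbors
  symm := ⟨by
    rintro (⟨m, n⟩ | ⟨m, n⟩) (⟨p, q⟩ | ⟨p, q⟩) h <;>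
      simp [neighbors] at h ⊢ <;> omega⟩
  loopless := ⟨by rintro (γ | γ) h <;> simp [neighbors] at h⟩

instance honeycombLocallyFinite : honeycomb.LocallyFinite := fun v =>
  Fintype.ofFinset v.neighbors (fun _ => Iff.rfl)

theorem honeycomb_isRegular : honeycomb.IsRegularOfDegree 3 := by
  intro v
  have h : honeycomb.neighborFinset v = v.neighbors := by
    ext w
    rw [SimpleGraph.mem_neighborFinset]
    rfl
  rw [← SimpleGraph.card_neighborFinset_eq_degree, h]
  rcases v with ⟨m, n⟩ | ⟨m, n⟩ <;> rw [HoneycombVertex.neighbors, Finset.card_eq_three] <;>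
    refine ⟨_, _, _, ?_, ?_, ?_, rfl⟩ <;> simp <;> omega

namespace HoneycombVertex

theorem dist_position_sq (v w : HoneycombVertex) :
    dist v.position w.position ^ 2 =
      (v.position 0 - w.position 0) ^ 2 + (v.position 1 - w.position 1) ^ 2 := by
  rw [EuclideanSpace.dist_eq, Real.sq_sqrt (by positivity)]
  simp [Real.dist_eq, sq_abs]

theorem dist_same (v w : HoneycombVertex) (k l : ℤ)
    (h0 : v.position 0 - w.position 0 = (k - l) * (√3 / 2))
    (h1 : v.position 1 - w.position 1 = (k + l) * (3 / 2)) :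
    dist v.position w.position ^ 2 = ((3 * (k ^ 2 + k * l + l ^ 2) : ℤ) : ℝ) := by
  rw [dist_position_sq, h0, h1]
  have h3 : √3 ^ 2 = 3 := Real.sq_sqrt (by norm_num)
  push_cast
  linear_combination ((k : ℝ) - l) ^ 2 / 4 * h3

theorem dist_diff (v w : HoneycombVertex) (k l : ℤ)
    (h0 : v.position 0 - w.position 0 = (k - l) * (√3 / 2))
    (h1 : v.position 1 - w.position 1 = 1 + (k + l) * (3 / 2)) :
    dist v.position w.position ^ 2 = ((3 * (k ^ 2 + k * l + l ^ 2 + k + l) + 1 : ℤ) : ℝ) := by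
  rw [dist_position_sq, h0, h1]
  have h3 : √3 ^ 2 = 3 := Real.sq_sqrt (by norm_num)
  push_cast
  linear_combination ((k : ℝ) - l) ^ 2 / 4 * h3

theorem quadratic_eq_zero_iff (k l : ℤ) :
    k ^ 2 + k * l + l ^ 2 + k + l = 0 ↔
      (k = 0 ∧ l = 0) ∨ (k = -1 ∧ l = 0) ∨ (k = 0 ∧ l = -1) := by
  constructor
  · intro h
    have hk : -2 < k ∧ k < 2 := by constructor <;> nlinarith [sq_nonneg (k + 2 * l + 1)]
    have hl : -2 < l ∧ l < 2 := by constructor <;> nlinarith [sq_nonneg (l + 2 * k + 1)]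
    obtain ⟨h1, h2⟩ := hk
    obtain ⟨h3, h4⟩ := hl
    interval_cases k <;> interval_cases l <;> simp_all
  · rintro (⟨rfl, rfl⟩ | ⟨rfl, rfl⟩ | ⟨rfl, rfl⟩) <;> norm_num

/-- Two vertices are joined by an edge of the tiling iff they are at distance one. -/
theorem honeycomb_adj_iff_dist (v w : HoneycombVertex) :
    honeycomb.Adj v w ↔ dist v.position w.position = 1 := by
  have hsq : dist v.position w.position = 1 ↔ dist v.position w.position ^ 2 = 1 := by
    rw [pow_eq_one_iff_of_nonneg dist_nonneg two_ne_zero]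
  rw [hsq]
  rcases v with ⟨m, n⟩ | ⟨m, n⟩ <;> rcases w with ⟨p, q⟩ | ⟨p, q⟩
  · rw [dist_same _ _ (m - p) (n - q) (by simp [position]; ring) (by simp [position]; ring)]
    norm_cast
    simp only [honeycomb, neighbors]
    simp
    omega
  · rw [dist_diff _ _ (m - p) (n - q) (by simp [position]; ring) (by simp [position]; ring)]
    norm_cast
    have := quadratic_eq_zero_iff (m - p) (n - q)
    simp only [honeycomb, neighbors]
    simp
    omega
  · rw [dist_comm, dist_diff _ _ (p - m) (q - n) (by simp [position]; ring)
      (by simp [position]; ring)]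
    norm_cast
    have := quadratic_eq_zero_iff (p - m) (q - n)
    simp only [honeycomb, neighbors]
    simp
    omega
  · rw [dist_same _ _ (m - p) (n - q) (by simp [position]; ring) (by simp [position]; ring)]
    norm_cast
    simp only [honeycomb, neighbors]
    simp
    omega

/-- Distinct vertices have distinct positions. -/
theorem position_injective : Function.Injective position := by
  intro v w h
  have hd : dist v.position w.position ^ 2 = 0 := by rw [h]; simp
  have key : ∀ k l : ℤ, 3 * (k ^ 2 + k * l + l ^ 2) = 0 → k = 0 ∧ l = 0 := by
    intro k l h
    constructor
    · have : k ^ 2 = 0 := by nlinarith [sq_nonneg (k + 2 * l), sq_nonneg k]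
      simpa using this
    · have : l ^ 2 = 0 := by nlinarith [sq_nonneg (l + 2 * k), sq_nonneg l]
      simpa using this
  rcases v with ⟨m, n⟩ | ⟨m, n⟩ <;> rcases w with ⟨p, q⟩ | ⟨p, q⟩
  · rw [dist_same _ _ (m - p) (n - q) (by simp [position]; ring) (by simp [position]; ring)] at hd
    have := key _ _ (by exact_mod_cast hd)
    simp
    omega
  · rw [dist_diff _ _ (m - p) (n - q) (by simp [position]; ring) (by simp [position]; ring)] at hd
    norm_cast at hd
    omega
  · rw [dist_comm, dist_diff _ _ (p - m) (q - n) (by simp [position]; ring)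
      (by simp [position]; ring)] at hd
    norm_cast at hd
    omega
  · rw [dist_same _ _ (m - p) (n - q) (by simp [position]; ring) (by simp [position]; ring)] at hd
    have := key _ _ (by exact_mod_cast hd)
    simp
    omega

/-- `translate` acts by graph automorphisms. -/
theorem honeycomb_adj_translate (γ : ℤ × ℤ) (v w : HoneycombVertex) :
    honeycomb.Adj (translate γ v) (translate γ w) ↔ honeycomb.Adj v w := by
  rcases v with ⟨m, n⟩ | ⟨m, n⟩ <;> rcases w with ⟨p, q⟩ | ⟨p, q⟩ <;>
    simp [honeycomb, neighbors, translate, Prod.ext_iff] <;> omega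

/-- Every vertex has exactly one representation `γ + q` with `q` in the fundamental domain. -/
theorem existsUnique_translate (v : HoneycombVertex) :
    ∃! p : (ℤ × ℤ) × HoneycombVertex, p.2 ∈ fundamentalDomain ∧ translate p.1 p.2 = v := by
  rcases v with γ | γ
  · refine ⟨(γ, a 0), by simp [fundamentalDomain, translate], ?_⟩
    rintro ⟨η, w⟩ ⟨h1, h2⟩
    simp only [fundamentalDomain, Finset.mem_insert, Finset.mem_singleton] at h1
    rcases h1 with rfl | rfl <;> simp_all [translate]
  · refine ⟨(γ, b 0), by simp [fundamentalDomain, translate], ?_⟩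
    rintro ⟨η, w⟩ ⟨h1, h2⟩
    simp only [fundamentalDomain, Finset.mem_insert, Finset.mem_singleton] at h1
    rcases h1 with rfl | rfl <;> simp_all [translate]

end HoneycombVertex

/-- The Laplacian on `ℓ²` of the vertex set of the honeycomb tiling. -/
def honeycombLaplacian :
    PeriodicGraph.EllTwo HoneycombVertex →L[ℂ] PeriodicGraph.EllTwo HoneycombVertex :=
  PeriodicGraph.laplacian honeycomb honeycomb_isRegular

/-- The integrated density of states of the honeycomb tiling. -/
def honeycombIDS (E : ℝ) : ℝ :=
  PeriodicGraph.ids honeycomb honeycomb_isRegular HoneycombVertex.fundamentalDomain E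

/-- The integrand `arccos ((9 (1 - E)² - 1) / (4 t) - t) / √(1 - t²)`. -/
def honeycombIntegrand (E t : ℝ) : ℝ :=
  Real.arccos ((9 * (1 - E) ^ 2 - 1) / (4 * t) - t) / √(1 - t ^ 2)

end

/-! Write `Δ = 1 - A/3` with `A` the adjacency operator. The graph is bipartite, so `A²` preserves
each of the two sublattices, where it is convolution on `ℤ²` with symbol `|1 + e^{iθ₁} + e^{iθ₂}|²`.
In the half-sum `β` and half-difference `α` of the angles this is `|1 + 2 cos α e^{iβ}|²`, even in
both variables, so `[0, π]²` suffices. Hence the spectral measure of `A` at every `δ_v` is the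
average of the point masses at `±√blochSq` over `[0, π]²`.

No direct integral is needed. The moments `⟪δ_v, Aⁿ δ_v⟫` are found from a recursion for Fourier
coefficients (`blochMoment_succ`, `honeycombAdjacency_pow_delta_self`), and Weierstrass
approximation extends the formula to continuous functions (`HasBlochMoments.inner_cfc`). The strong
limit of `(1 + n f(A))⁻¹` together with dominated convergence then reaches kernel projections
(`HasBlochMoments.inner_starProjection_ker_cfc`).

So `N(E)` is a normalized area of level regions of `blochSq`. For fixed `α` the condition is linear
in `cos β`, which produces the arccosine; substituting `t = cos α` produces `1 / √(1 - t²)`. Level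
curves have measure zero, which gives both the antisymmetry and the absence of eigenvalues. -/

open Filter Topology

/-! ### Kernel projections as strong limits in the functional calculus -/

/-- The operators `(1 + n f(T))⁻¹` converge strongly to the orthogonal projection onto the kernel
of `f(T)`. -/
theorem tendsto_cfc_one_div_starProjection_ker {H : Type*} [NormedAddCommGroup H]
    [InnerProductSpace ℂ H] [CompleteSpace H] {T : H →L[ℂ] H} (hT : IsSelfAdjoint T)
    {f : ℝ → ℝ} (hf : Continuous f) (h0 : ∀ x, 0 ≤ f x)
    (K : Submodule ℂ H) [K.HasOrthogonalProjection]
    (hK : K = LinearMap.ker (cfc f T).toLinearMap) (x : H) :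
    Tendsto (fun n : ℕ => cfc (fun y => 1 / (1 + n * f y)) T x) atTop
      (𝓝 (K.starProjection x)) := by
  set B : H →L[ℂ] H := cfc f T with hB
  set R : ℕ → H →L[ℂ] H := fun n => cfc (fun y => 1 / (1 + n * f y)) T with hR
  have hpos : ∀ (n : ℕ) y, 0 < 1 + n * f y := fun n y => by
    have := h0 y
    positivity
  have hcont : ∀ n : ℕ, Continuous fun y => 1 / (1 + n * f y) := fun n =>
    continuous_const.div (by fun_prop) fun y => (hpos n y).ne'
  have hRB : ∀ n, R n * B = cfc (fun y => 1 / (1 + n * f y) * f y) T := fun n =>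
    (cfc_mul _ _ T (hcont n).continuousOn hf.continuousOn).symm
  have hker : ∀ n y, y ∈ K → R n y = y := by
    intro n y hy
    -- `R n` inverts `1 + n B`, so it fixes every vector killed by `B`.
    have h1 : R n + (n : ℝ) • (R n * B) = 1 := by
      rw [hRB, hR]
      dsimp only
      have hc : Continuous fun y => 1 / (1 + n * f y) * f y := (hcont n).mul hf
      have hc' : Continuous fun y => (n : ℝ) • (1 / (1 + n * f y) * f y) := hc.const_smul (n : ℝ)
      rw [← cfc_smul (n : ℝ) _ T hc.continuousOn,
        ← cfc_add (a := T) _ _ (hcont n).continuousOn hc'.continuousOn, ← cfc_const_one ℝ T]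
      refine cfc_congr fun y _ => ?_
      have := (hpos n y).ne'
      simp only [smul_eq_mul]
      field_simp
    have hy' : B y = 0 := by rw [hK] at hy; exact hy
    have h2 := congrArg (fun S : H →L[ℂ] H => S y) h1
    simpa [hy'] using h2
  have hnorm : ∀ n, ‖R n‖ ≤ 1 := fun n => by
    refine norm_cfc_le zero_le_one fun y _ => ?_
    rw [Real.norm_of_nonneg (by have := hpos n y; positivity), div_le_one (hpos n y)]
    have := h0 y
    have : 0 ≤ n * f y := by positivity
    linarith
  have hnormB : ∀ n : ℕ, 0 < n → ‖R n * B‖ ≤ 1 / n := fun n hn => by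
    rw [hRB]
    refine norm_cfc_le (by positivity) fun y _ => ?_
    have h1 := hpos n y
    have h2 := h0 y
    have hn' : (0 : ℝ) < n := by exact_mod_cast hn
    rw [Real.norm_of_nonneg (by positivity), one_div_mul_eq_div, div_le_div_iff₀ h1 hn']
    linarith
  have hBsa : IsSelfAdjoint B := cfc_predicate f T
  have hperp : ∀ y ∈ Kᗮ, Tendsto (fun n => R n y) atTop (𝓝 0) := by
    intro y hy
    -- `B` is self-adjoint, so `Kᗮ` is the closure of its range. On the range `R n` is `O(1/n)`, and
    -- `‖R n‖ ≤ 1` carries the convergence to the closure.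
    have hcl : y ∈ closure (Set.range B) := by
      have h1 : Kᗮ = B.range.topologicalClosure := by
        have h2 := ContinuousLinearMap.orthogonal_ker B
        rw [hBsa.adjoint_eq] at h2
        rw [hK]
        exact h2
      rw [h1] at hy
      exact hy
    rw [Metric.tendsto_atTop]
    intro ε hε
    obtain ⟨_, ⟨z, rfl⟩, hz⟩ := Metric.mem_closure_iff.1 hcl (ε / 2) (by positivity)
    have ht : Tendsto (fun n : ℕ => ‖z‖ / (n : ℝ)) atTop (𝓝 0) :=
      tendsto_const_div_atTop_nhds_zero_nat _
    obtain ⟨N, hN⟩ := Metric.tendsto_atTop.1 ht (ε / 2) (by positivity)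
    refine ⟨N + 1, fun n hn => ?_⟩
    have hn0 : 0 < n := by omega
    have h3 : ‖R n (B z)‖ < ε / 2 := by
      calc ‖R n (B z)‖ = ‖(R n * B) z‖ := rfl
        _ ≤ ‖R n * B‖ * ‖z‖ := ContinuousLinearMap.le_opNorm _ _
        _ ≤ 1 / n * ‖z‖ := by gcongr; exact hnormB n hn0
        _ = ‖z‖ / n := by ring
        _ < ε / 2 := by
          have := hN n (by omega)
          rw [Real.dist_eq, sub_zero] at this
          exact (le_abs_self _).trans_lt this
    have h4 : ‖R n (y - B z)‖ < ε / 2 := by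
      calc ‖R n (y - B z)‖ ≤ ‖R n‖ * ‖y - B z‖ := ContinuousLinearMap.le_opNorm _ _
        _ ≤ 1 * ‖y - B z‖ := by gcongr; exact hnorm n
        _ < ε / 2 := by rwa [one_mul, ← dist_eq_norm]
    rw [dist_zero_right]
    calc ‖R n y‖ = ‖R n (y - B z) + R n (B z)‖ := by rw [← map_add, sub_add_cancel]
      _ ≤ ‖R n (y - B z)‖ + ‖R n (B z)‖ := norm_add_le _ _
      _ < ε := by linarith
  have hdecomp : ∀ n, R n x = K.starProjection x + R n (x - K.starProjection x) := fun n => by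
    rw [map_sub, hker n _ (K.starProjection_apply_mem x), add_sub_cancel]
  change Tendsto (fun n => R n x) _ _
  simp_rw [hdecomp]
  simpa using tendsto_const_nhds.add (hperp _ (K.sub_starProjection_mem_orthogonal x))

/-! ### The Bloch symbol and the slices of its level regions -/

/-- The squared modulus `|1 + 2 cos α e^{iβ}|²` of the Bloch symbol of the honeycomb lattice. -/
noncomputable def blochSq (p : ℝ × ℝ) : ℝ :=
  1 + 4 * Real.cos p.1 * Real.cos p.2 + 4 * Real.cos p.1 ^ 2

/-- Lebesgue measure on `[0, π]`. -/
noncomputable def halfPeriod : Measure ℝ := volume.restrict (Set.Icc 0 Real.pi)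

/-- Lebesgue measure on `[0, π]²`. -/
noncomputable def quasiMomentum : Measure (ℝ × ℝ) := halfPeriod.prod halfPeriod

instance isFiniteMeasure_halfPeriod : IsFiniteMeasure halfPeriod := by
  unfold halfPeriod; infer_instance

instance isFiniteMeasure_quasiMomentum : IsFiniteMeasure quasiMomentum := by
  unfold quasiMomentum; infer_instance

theorem halfPeriod_real_univ : halfPeriod.real Set.univ = Real.pi := by
  simp [halfPeriod, Real.pi_pos.le]

theorem quasiMomentum_real_univ : quasiMomentum.real Set.univ = Real.pi ^ 2 := by
  rw [quasiMomentum, ← Set.univ_prod_univ, measureReal_prod_prod, halfPeriod_real_univ, sq]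

theorem continuous_blochSq : Continuous blochSq := by
  unfold blochSq; fun_prop

theorem measurable_blochSq : Measurable blochSq := continuous_blochSq.measurable

/-- The symbol equals `(1 + 2 cos α cos β)² + 4 cos² α (1 - cos² β)`. -/
theorem blochSq_nonneg (p : ℝ × ℝ) : 0 ≤ blochSq p := by
  unfold blochSq
  nlinarith [sq_nonneg (1 + 2 * Real.cos p.1 * Real.cos p.2), Real.cos_sq_le_one p.2,
    sq_nonneg (Real.cos p.1), mul_nonneg (sq_nonneg (Real.cos p.1))
      (sub_nonneg.2 (Real.cos_sq_le_one p.2))]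

theorem blochSq_le (p : ℝ × ℝ) : blochSq p ≤ 9 := by
  have h1 := abs_le.1 (Real.abs_cos_le_one p.1)
  have h2 := abs_le.1 (Real.abs_cos_le_one p.2)
  unfold blochSq
  nlinarith [mul_nonneg (sub_nonneg.2 h1.2) (sub_nonneg.2 h2.1), Real.cos_sq_le_one p.1,
    mul_nonneg (sub_nonneg.2 h1.2) (by linarith [h2.1] : 0 ≤ 1 + Real.cos p.2),
    mul_nonneg (by linarith [h1.1] : 0 ≤ 1 + Real.cos p.1) (sub_nonneg.2 h2.2)]

theorem sqrt_blochSq_le (p : ℝ × ℝ) : √(blochSq p) ≤ 3 := by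
  rw [Real.sqrt_le_left (by norm_num)]
  norm_num [blochSq_le p]

/-- No bound on `y` is required: `Real.arccos` is `0` above `1` and `π` below `-1`, matching the
empty and the full slice. -/
theorem halfPeriod_real_le_cos (y : ℝ) :
    halfPeriod.real {β | y ≤ Real.cos β} = Real.arccos y := by
  rw [halfPeriod, measureReal_restrict_apply (measurableSet_le measurable_const
    Real.measurable_cos)]
  rcases lt_or_ge 1 y with h | h
  · have : {β | y ≤ Real.cos β} ∩ Set.Icc 0 Real.pi = ∅ := by
      ext β
      simp only [Set.mem_inter_iff, Set.mem_ofPred_eq, Set.mem_empty_iff_false, iff_false, not_and]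
      intro h'
      linarith [Real.cos_le_one β]
    rw [this, Real.arccos_of_one_le h.le]
    simp
  · have : {β | y ≤ Real.cos β} ∩ Set.Icc 0 Real.pi = Set.Icc 0 (Real.arccos y) := by
      ext β
      simp only [Set.mem_inter_iff, Set.mem_ofPred_eq, Set.mem_Icc]
      constructor
      · rintro ⟨h1, h2, h3⟩
        refine ⟨h2, ?_⟩
        rw [← Real.arccos_cos h2 h3]
        exact Real.arccos_le_arccos h1
      · rintro ⟨h1, h2⟩
        refine ⟨?_, h1, h2.trans (Real.arccos_le_pi y)⟩
        rcases lt_or_ge y (-1) with h3 | h3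
        · linarith [Real.neg_one_le_cos β]
        · rw [← Real.cos_arccos h3 h]
          exact Real.cos_le_cos_of_nonneg_of_le_pi h1 (Real.arccos_le_pi y) h2
    rw [this, Real.volume_real_Icc, sub_zero, max_eq_left (Real.arccos_nonneg y)]

theorem halfPeriod_real_cos_le (y : ℝ) :
    halfPeriod.real {β | Real.cos β ≤ y} = Real.arccos (-y) := by
  have h : MeasurePreserving (fun β => Real.pi - β) halfPeriod halfPeriod := by
    have h1 := (Measure.measurePreserving_sub_left volume Real.pi).restrict_preimage
      (s := Set.Icc 0 Real.pi) measurableSet_Icc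
    have h2 : (fun β => Real.pi - β) ⁻¹' Set.Icc 0 Real.pi = Set.Icc 0 Real.pi := by
      simp
    rw [h2] at h1
    exact h1
  rw [← halfPeriod_real_le_cos (-y), measureReal_def, measureReal_def,
    ← h.measure_preimage (measurableSet_le measurable_const Real.measurable_cos).nullMeasurableSet]
  congr 2
  ext β
  simp

theorem ae_cos_ne_zero : ∀ᵐ α ∂halfPeriod, Real.cos α ≠ 0 := by
  rw [halfPeriod, ae_restrict_iff' measurableSet_Icc]
  have : ∀ᵐ α : ℝ, α ≠ Real.pi / 2 := by simp [ae_iff]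
  filter_upwards [this] with α h1 h2 h3
  apply h1
  apply Real.injOn_cos h2 ⟨by positivity, by linarith [Real.pi_pos]⟩
  rw [h3, Real.cos_pi_div_two]

theorem quasiMomentum_real_eq_integral {s : Set (ℝ × ℝ)} (hs : MeasurableSet s) :
    quasiMomentum.real s = ∫ α, halfPeriod.real (Prod.mk α ⁻¹' s) ∂halfPeriod := by
  rw [quasiMomentum, ← integral_indicator_one hs, integral_prod]
  · refine integral_congr_ae (.of_forall fun α => ?_)
    dsimp only
    rw [← integral_indicator_one (measurable_prodMk_left hs)]
    rfl
  · exact (integrable_const (1 : ℝ)).indicator hs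

/-- The level sets of the dispersion relation are null sets. -/
theorem quasiMomentum_real_blochSq_eq (s : ℝ) : quasiMomentum.real {p | blochSq p = s} = 0 := by
  rw [quasiMomentum_real_eq_integral (measurableSet_eq_fun measurable_blochSq measurable_const)]
  rw [integral_eq_zero_of_ae]
  filter_upwards [ae_cos_ne_zero] with α hα
  -- When `cos α ≠ 0` the equation is linear in `cos β`, and cosine is injective on `[0, π]`: the
  -- slice has at most one point.
  have hsub : Prod.mk α ⁻¹' {p | blochSq p = s} ∩ Set.Icc 0 Real.pi ⊆
      {Real.arccos ((s - 1) / (4 * Real.cos α) - Real.cos α)} := by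
    rintro β ⟨h1, h2⟩
    simp only [Set.mem_preimage, Set.mem_ofPred_eq, blochSq] at h1
    rw [Set.mem_singleton_iff, ← Real.arccos_cos h2.1 h2.2]
    congr 1
    field_simp
    linear_combination h1
  rw [halfPeriod, measureReal_restrict_apply (measurable_prodMk_left
    (measurableSet_eq_fun measurable_blochSq measurable_const)), measureReal_def,
    measure_mono_null hsub (by simp)]
  rfl

/-- Solve for `cos β`. If `cos α < 0` the inequality flips, and the reflection `β ↦ π - β` flips it
back with `|cos α|` in place of `cos α`. -/
theorem halfPeriod_real_le_blochSq (s : ℝ) {α : ℝ} (hα : Real.cos α ≠ 0) :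
    halfPeriod.real {β | s ≤ blochSq (α, β)} =
      Real.arccos ((s - 1) / (4 * |Real.cos α|) - |Real.cos α|) := by
  rcases hα.lt_or_gt with h | h
  · rw [abs_of_neg h, show (s - 1) / (4 * -Real.cos α) - -Real.cos α =
      -((s - 1) / (4 * Real.cos α) - Real.cos α) by field_simp; ring, ← halfPeriod_real_cos_le]
    congr 1
    ext β
    simp only [Set.mem_ofPred_eq, blochSq]
    rw [le_sub_iff_add_le, le_div_iff_of_neg (by linarith)]
    constructor <;> intro <;> linarith
  · rw [abs_of_pos h, ← halfPeriod_real_le_cos]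
    congr 1
    ext β
    simp only [Set.mem_ofPred_eq, blochSq]
    rw [sub_le_iff_le_add, div_le_iff₀ (by linarith)]
    constructor <;> intro <;> linarith

/-- The opposite inequality gives the same arccosine expression at `t = -|cos α|`. This is why the
integrals near the band centre run over negative `t` for `E < 1`. -/
theorem halfPeriod_real_blochSq_le (s : ℝ) {α : ℝ} (hα : Real.cos α ≠ 0) :
    halfPeriod.real {β | blochSq (α, β) ≤ s} =
      Real.arccos ((s - 1) / (4 * -|Real.cos α|) - -|Real.cos α|) := by
  rcases hα.lt_or_gt with h | h
  · rw [abs_of_neg h, neg_neg, ← halfPeriod_real_le_cos]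
    congr 1
    ext β
    simp only [Set.mem_ofPred_eq, blochSq]
    rw [sub_le_iff_le_add, div_le_iff_of_neg (by linarith)]
    constructor <;> intro <;> linarith
  · rw [abs_of_pos h, show (s - 1) / (4 * -Real.cos α) - -Real.cos α =
      -((s - 1) / (4 * Real.cos α) - Real.cos α) by field_simp; ring, ← halfPeriod_real_cos_le]
    congr 1
    ext β
    simp only [Set.mem_ofPred_eq, blochSq]
    rw [le_sub_iff_add_le, le_div_iff₀ (by linarith)]
    constructor <;> intro <;> linarith

/-! ### The change of variables and the symmetry about `π / 2` -/

theorem integral_halfPeriod (f : ℝ → ℝ) : ∫ α, f α ∂halfPeriod = ∫ α in (0)..Real.pi, f α := by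
  rw [halfPeriod, integral_Icc_eq_integral_Ioc, intervalIntegral.integral_of_le Real.pi_pos.le]

/-- The substitution `t = cos α`. -/
theorem integrableOn_div_sqrt_and_integral {f : ℝ → ℝ} {a b : ℝ} (ha : -1 ≤ a)
    (hab : a ≤ b) (hb : b ≤ 1)
    (hf : IntegrableOn (fun α => f (Real.cos α)) (Set.Icc 0 Real.pi)) :
    IntervalIntegrable (fun t => f t / √(1 - t ^ 2)) volume a b ∧
      ∫ t in a..b, f t / √(1 - t ^ 2) =
        ∫ α in (Real.arccos b)..(Real.arccos a), f (Real.cos α) := by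
  have him : Real.arccos '' Set.Ioo a b = Set.Ioo (Real.arccos b) (Real.arccos a) := by
    ext α
    constructor
    · rintro ⟨t, ⟨h1, h2⟩, rfl⟩
      exact ⟨Real.strictAntiOn_arccos ⟨by linarith, by linarith⟩ ⟨by linarith, hb⟩ h2,
        Real.strictAntiOn_arccos ⟨ha, by linarith⟩ ⟨by linarith, by linarith⟩ h1⟩
    · rintro ⟨h1, h2⟩
      have h3 := Real.arccos_nonneg b
      have h4 := Real.arccos_le_pi a
      refine ⟨Real.cos α, ⟨?_, ?_⟩, Real.arccos_cos (by linarith) (by linarith)⟩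
      · rw [← Real.cos_arccos ha (by linarith)]
        exact Real.cos_lt_cos_of_nonneg_of_le_pi (by linarith) h4 h2
      · rw [← Real.cos_arccos (by linarith) hb]
        exact Real.cos_lt_cos_of_nonneg_of_le_pi h3 (by linarith) h1
  -- The open interval avoids `±1`, where `arccos` is not differentiable. The singular weight is the
  -- Jacobian, so integrability is inherited from the integrand in `α`.
  have hderiv : ∀ t ∈ Set.Ioo a b,
      HasDerivWithinAt Real.arccos (-(1 / √(1 - t ^ 2))) (Set.Ioo a b) t := fun t ht =>
    (Real.hasDerivAt_arccos (by linarith [ht.1]) (by linarith [ht.2])).hasDerivWithinAt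
  have hinj : Set.InjOn Real.arccos (Set.Ioo a b) := Real.arccos_injOn.mono fun t ht =>
    Set.mem_Icc.2 ⟨by linarith [ht.1], by linarith [ht.2]⟩
  have heq : ∀ t ∈ Set.Ioo a b,
      |-(1 / √(1 - t ^ 2))| • f (Real.cos (Real.arccos t)) = f t / √(1 - t ^ 2) := fun t ht => by
    rw [Real.cos_arccos (by linarith [ht.1]) (by linarith [ht.2]), abs_neg,
      abs_of_nonneg (by positivity), smul_eq_mul]
    ring
  constructor
  · rw [intervalIntegrable_iff_integrableOn_Ioo_of_le hab,
      ← integrableOn_congr_fun heq measurableSet_Ioo,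
      ← integrableOn_image_iff_integrableOn_abs_deriv_smul measurableSet_Ioo hderiv hinj
        (fun α => f (Real.cos α)), him]
    exact hf.mono_set fun α hα => ⟨(Real.arccos_nonneg b).trans hα.1.le,
      hα.2.le.trans (Real.arccos_le_pi a)⟩
  · rw [intervalIntegral.integral_of_le hab, integral_Ioc_eq_integral_Ioo,
      ← setIntegral_congr_fun measurableSet_Ioo heq,
      ← integral_image_eq_integral_abs_deriv_smul measurableSet_Ioo hderiv hinj
        (fun α => f (Real.cos α)), him,
      intervalIntegral.integral_of_le (Real.antitone_arccos hab), integral_Ioc_eq_integral_Ioo]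

theorem integrableOn_arccos {y : ℝ → ℝ} (hy : Measurable y) :
    IntegrableOn (fun α => Real.arccos (y α)) (Set.Icc 0 Real.pi) := by
  refine Measure.integrableOn_of_bounded (M := Real.pi) (by simp) ?_ (.of_forall fun α => ?_)
  · exact Measurable.aestronglyMeasurable (by fun_prop)
  · rw [Real.norm_of_nonneg (Real.arccos_nonneg _)]
    exact Real.arccos_le_pi _

/-- An integral over `[0, π]` which is symmetric about `π / 2` is twice the integral over a
subinterval of either half outside which the integrand vanishes. -/
theorem integral_symm_eq_two_mul {f g : ℝ → ℝ} (hg : IntegrableOn g (Set.Icc 0 Real.pi))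
    (hsymm : ∀ α, f (Real.pi - α) = f α) {u v : ℝ} (hu : 0 ≤ u) (huv : u ≤ v)
    (hv : v ≤ Real.pi / 2) (hfg : ∀ α ∈ Set.Ioo 0 (Real.pi / 2), f α = g α)
    (h0 : ∀ α ∈ Set.Ioo 0 u, g α = 0) (h1 : ∀ α ∈ Set.Ioo v (Real.pi / 2), g α = 0) :
    ∫ α in (0)..Real.pi, f α = 2 * ∫ α in u..v, g α := by
  have hp := Real.pi_pos
  have hint : ∀ a b : ℝ, 0 ≤ a → a ≤ b → b ≤ Real.pi → IntervalIntegrable g volume a b :=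
    fun a b ha hab hb => (intervalIntegrable_iff_integrableOn_Icc_of_le hab).2
      (hg.mono_set (Set.Icc_subset_Icc ha hb))
  have hf1 : IntervalIntegrable f volume 0 (Real.pi / 2) := by
    have := hint 0 (Real.pi / 2) le_rfl (by positivity) (by linarith)
    rw [intervalIntegrable_iff_integrableOn_Ioo_of_le (by positivity)] at this ⊢
    exact (integrableOn_congr_fun hfg measurableSet_Ioo).2 this
  have hf2 : IntervalIntegrable f volume (Real.pi / 2) Real.pi := by
    have := (hf1.comp_sub_left Real.pi).symm
    simp only [hsymm, sub_zero] at this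
    convert this using 1
    ring
  have hf3 : ∫ α in (Real.pi / 2)..Real.pi, f α = ∫ α in (0)..(Real.pi / 2), f α := by
    have := intervalIntegral.integral_comp_sub_left f (a := 0) (b := Real.pi / 2) Real.pi
    simp only [hsymm, sub_zero] at this
    rw [this]
    congr 1
    ring
  have hz : ∀ a b : ℝ, a ≤ b → (∀ α ∈ Set.Ioo a b, g α = 0) → ∫ α in a..b, g α = 0 := by
    intro a b hab h
    rw [intervalIntegral.integral_of_le hab, integral_Ioc_eq_integral_Ioo,
      setIntegral_congr_fun measurableSet_Ioo h]
    simp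
  have hf4 : ∫ α in (0)..(Real.pi / 2), f α = ∫ α in (0)..(Real.pi / 2), g α := by
    rw [intervalIntegral.integral_of_le (by positivity),
      intervalIntegral.integral_of_le (by positivity), integral_Ioc_eq_integral_Ioo,
      integral_Ioc_eq_integral_Ioo, setIntegral_congr_fun measurableSet_Ioo hfg]
  rw [← intervalIntegral.integral_add_adjacent_intervals hf1 hf2, hf3, hf4,
    ← intervalIntegral.integral_add_adjacent_intervals
      (hint 0 u le_rfl hu (by linarith)) (hint u (Real.pi / 2) hu (by linarith) (by linarith)),
    ← intervalIntegral.integral_add_adjacent_intervals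
      (hint u v hu huv (by linarith)) (hint v (Real.pi / 2) (by linarith) hv (by linarith)),
    hz 0 u hu h0, hz v _ hv h1]
  ring

/-! ### Fourier coefficients of the symbol and moments of the adjacency operator -/

/-- The Fourier coefficients of the powers of the squared Bloch symbol. -/
noncomputable def blochMoment (k : ℕ) (γ : ℤ × ℤ) : ℝ :=
  ∫ p, blochSq p ^ k * (Real.cos ((γ.1 - γ.2) * p.1) * Real.cos ((γ.1 + γ.2) * p.2))
    ∂quasiMomentum

theorem integrable_quasiMomentum_of_continuous {f : ℝ × ℝ → ℝ} (hf : Continuous f) :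
    Integrable f quasiMomentum := by
  rw [quasiMomentum, halfPeriod, Measure.prod_restrict, ← Measure.volume_eq_prod]
  exact hf.continuousOn.integrableOn_compact (isCompact_Icc.prod isCompact_Icc)

theorem integral_cos_int_mul (m : ℤ) :
    ∫ α, Real.cos (m * α) ∂halfPeriod = if m = 0 then Real.pi else 0 := by
  rw [integral_halfPeriod]
  split_ifs with h
  · simp [h]
  · have : (m : ℝ) ≠ 0 := by exact_mod_cast h
    rw [intervalIntegral.integral_comp_mul_left _ this]
    simp [Real.sin_int_mul_pi]

/-- Orthogonality of cosines: both frequencies `γ₁ - γ₂` and `γ₁ + γ₂` vanish only for `γ = 0`. -/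
theorem blochMoment_zero (γ : ℤ × ℤ) :
    blochMoment 0 γ = if γ = 0 then Real.pi ^ 2 else 0 := by
  have h1 := integral_cos_int_mul (γ.1 - γ.2)
  have h2 := integral_cos_int_mul (γ.1 + γ.2)
  push_cast at h1 h2
  simp only [blochMoment, pow_zero, one_mul]
  rw [quasiMomentum, integral_prod_mul (fun x : ℝ => Real.cos ((γ.1 - γ.2) * x))
    (fun x : ℝ => Real.cos ((γ.1 + γ.2) * x)), h1, h2]
  rcases γ with ⟨m, n⟩
  simp only [Prod.mk_eq_zero]
  split_ifs <;> first | omega | ring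

/-- The symbol is `3 + 2 cos(β + α) + 2 cos(β - α) + 2 cos 2α`. By product-to-sum formulas,
multiplying by it shifts `γ` to itself three times and to its six nearest lattice neighbours once
each. These are the two-step walks on one sublattice. -/
theorem blochMoment_succ (k : ℕ) (γ : ℤ × ℤ) :
    blochMoment (k + 1) γ = 3 * blochMoment k γ
      + blochMoment k (γ + (1, 0)) + blochMoment k (γ + (0, 1))
      + blochMoment k (γ - (1, 0)) + blochMoment k (γ - (0, 1))
      + blochMoment k (γ + (1, 0) - (0, 1)) + blochMoment k (γ + (0, 1) - (1, 0)) := by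
  set F : ℤ × ℤ → ℝ × ℝ → ℝ := fun η p => blochSq p ^ k *
    (Real.cos ((η.1 - η.2) * p.1) * Real.cos ((η.1 + η.2) * p.2)) with hF
  have hc : ∀ η, Continuous (F η) := fun η => by
    have := continuous_blochSq
    fun_prop
  have hM : ∀ η, blochMoment k η = ∫ p, F η p ∂quasiMomentum := fun _ => rfl
  have hsum : 3 * blochMoment k γ
      + blochMoment k (γ + (1, 0)) + blochMoment k (γ + (0, 1))
      + blochMoment k (γ - (1, 0)) + blochMoment k (γ - (0, 1))
      + blochMoment k (γ + (1, 0) - (0, 1)) + blochMoment k (γ + (0, 1) - (1, 0)) =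
      ∫ p, (3 * F γ p + F (γ + (1, 0)) p + F (γ + (0, 1)) p + F (γ - (1, 0)) p
        + F (γ - (0, 1)) p + F (γ + (1, 0) - (0, 1)) p + F (γ + (0, 1) - (1, 0)) p)
        ∂quasiMomentum := by
    simp only [hM]
    rw [integral_add, integral_add, integral_add, integral_add, integral_add, integral_add,
      integral_const_mul] <;>
    exact integrable_quasiMomentum_of_continuous (by fun_prop)
  rw [hsum, blochMoment]
  refine integral_congr_ae (.of_forall fun p => ?_)
  simp only [hF]
  rcases γ with ⟨m, n⟩
  rcases p with ⟨α, β⟩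
  simp only [Prod.fst_add, Prod.snd_add, Prod.fst_sub, Prod.snd_sub, Int.cast_add,
    Int.cast_sub, Int.cast_one, Int.cast_zero]
  have e1 : ((m : ℝ) + 1 - (n + 0)) * α = (m - n) * α + α := by ring
  have e2 : ((m : ℝ) + 1 + (n + 0)) * β = (m + n) * β + β := by ring
  have e3 : ((m : ℝ) + 0 - (n + 1)) * α = (m - n) * α - α := by ring
  have e4 : ((m : ℝ) + 0 + (n + 1)) * β = (m + n) * β + β := by ring
  have e5 : ((m : ℝ) - 1 - (n - 0)) * α = (m - n) * α - α := by ring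
  have e6 : ((m : ℝ) - 1 + (n - 0)) * β = (m + n) * β - β := by ring
  have e7 : ((m : ℝ) - 0 - (n - 1)) * α = (m - n) * α + α := by ring
  have e8 : ((m : ℝ) - 0 + (n - 1)) * β = (m + n) * β - β := by ring
  have e9 : ((m : ℝ) + 1 - 0 - (n + 0 - 1)) * α = (m - n) * α + 2 * α := by ring
  have e10 : ((m : ℝ) + 1 - 0 + (n + 0 - 1)) * β = (m + n) * β := by ring
  have e11 : ((m : ℝ) + 0 - 1 - (n + 1 - 0)) * α = (m - n) * α - 2 * α := by ring
  have e12 : ((m : ℝ) + 0 - 1 + (n + 1 - 0)) * β = (m + n) * β := by ring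
  rw [e1, e2, e3, e4, e5, e6, e7, e8, e9, e10, e11, e12]
  simp only [Real.cos_add, Real.cos_sub, Real.cos_two_mul, blochSq]
  ring

open PeriodicGraph HoneycombVertex

/-- The adjacency operator of the honeycomb lattice. -/
noncomputable def honeycombAdjacency : EllTwo HoneycombVertex →L[ℂ] EllTwo HoneycombVertex :=
  adjacencyOp honeycomb honeycomb_isRegular

theorem honeycomb_neighborFinset (v : HoneycombVertex) :
    honeycomb.neighborFinset v = v.neighbors := by
  ext w
  rw [SimpleGraph.mem_neighborFinset]
  rfl

theorem honeycombAdjacency_apply_a (f : EllTwo HoneycombVertex) (γ : ℤ × ℤ) :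
    honeycombAdjacency f (a γ) = f (b γ) + f (b (γ + (1, 0))) + f (b (γ + (0, 1))) := by
  rw [honeycombAdjacency, adjacencyOp_apply, honeycomb_neighborFinset, neighbors,
    Finset.sum_insert (by simp), Finset.sum_insert (by simp), Finset.sum_singleton, add_assoc]

theorem honeycombAdjacency_apply_b (f : EllTwo HoneycombVertex) (γ : ℤ × ℤ) :
    honeycombAdjacency f (b γ) = f (a γ) + f (a (γ - (1, 0))) + f (a (γ - (0, 1))) := by
  rw [honeycombAdjacency, adjacencyOp_apply, honeycomb_neighborFinset, neighbors,
    Finset.sum_insert (by simp [Prod.ext_iff]; omega), Finset.sum_insert (by simp),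
    Finset.sum_singleton, add_assoc]

theorem delta_apply {V : Type*} [DecidableEq V] (v w : V) :
    (delta v : EllTwo V) w = if w = v then 1 else 0 := by
  unfold delta
  by_cases h : w = v
  · subst h; simp
  · simp [h]

theorem honeycombAdjacency_pow_even_succ (k : ℕ) (f : EllTwo HoneycombVertex) :
    (honeycombAdjacency ^ (2 * (k + 1))) f =
      honeycombAdjacency (honeycombAdjacency ((honeycombAdjacency ^ (2 * k)) f)) := by
  rw [show 2 * (k + 1) = 2 * k + 1 + 1 by ring, pow_succ', pow_succ']
  rfl

/-- Applying `A` twice yields the recursion of `blochMoment_succ` with the same initial value. The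
vanishing on the other sublattice is carried along in the induction. -/
theorem honeycombAdjacency_pow_even_delta_a (k : ℕ) (η γ : ℤ × ℤ) :
    (honeycombAdjacency ^ (2 * k)) (delta (a η)) (a γ) =
        ((Real.pi ^ 2)⁻¹ * blochMoment k (γ - η) : ℝ) ∧
      (honeycombAdjacency ^ (2 * k)) (delta (a η)) (b γ) = 0 := by
  induction k generalizing γ with
  | zero =>
    simp only [mul_zero, pow_zero, one_apply_eq_self, delta_apply, blochMoment_zero,
      sub_eq_zero, a.injEq]
    constructor
    · split_ifs <;> simp [Real.pi_ne_zero]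
    · simp
  | succ k ih =>
    rw [honeycombAdjacency_pow_even_succ, blochMoment_succ]
    simp only [honeycombAdjacency_apply_a, honeycombAdjacency_apply_b, (ih _).1, (ih _).2,
      add_sub_cancel_right]
    refine ⟨?_, by simp⟩
    rw [show γ - η + (1, 0) = γ + (1, 0) - η by abel, show γ - η + (0, 1) = γ + (0, 1) - η by abel,
      show γ - η - (1, 0) = γ - (1, 0) - η by abel, show γ - η - (0, 1) = γ - (0, 1) - η by abel,
      show γ + (1, 0) - η - (0, 1) = γ + (1, 0) - (0, 1) - η by abel,
      show γ + (0, 1) - η - (1, 0) = γ + (0, 1) - (1, 0) - η by abel]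
    push_cast
    ring

theorem honeycombAdjacency_pow_even_delta_b (k : ℕ) (η γ : ℤ × ℤ) :
    (honeycombAdjacency ^ (2 * k)) (delta (b η)) (b γ) =
        ((Real.pi ^ 2)⁻¹ * blochMoment k (γ - η) : ℝ) ∧
      (honeycombAdjacency ^ (2 * k)) (delta (b η)) (a γ) = 0 := by
  induction k generalizing γ with
  | zero =>
    simp only [mul_zero, pow_zero, one_apply_eq_self, delta_apply, blochMoment_zero,
      sub_eq_zero, b.injEq]
    constructor
    · split_ifs <;> simp [Real.pi_ne_zero]
    · simp
  | succ k ih =>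
    rw [honeycombAdjacency_pow_even_succ, blochMoment_succ]
    simp only [honeycombAdjacency_apply_a, honeycombAdjacency_apply_b, (ih _).1, (ih _).2,
      sub_add_cancel]
    refine ⟨?_, by simp⟩
    rw [show γ - η + (1, 0) = γ + (1, 0) - η by abel, show γ - η + (0, 1) = γ + (0, 1) - η by abel,
      show γ - η - (1, 0) = γ - (1, 0) - η by abel, show γ - η - (0, 1) = γ - (0, 1) - η by abel,
      show γ + (1, 0) - η - (0, 1) = γ - (0, 1) + (1, 0) - η by abel,
      show γ + (0, 1) - η - (1, 0) = γ - (1, 0) + (0, 1) - η by abel]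
    push_cast
    ring

/-- Odd moments vanish on both sides: a bipartite graph has no closed walk of odd length, and the
two signs cancel under the integral. -/
theorem honeycombAdjacency_pow_delta_self (n : ℕ) (v : HoneycombVertex) :
    (honeycombAdjacency ^ n) (delta v) v =
      ((2 * Real.pi ^ 2)⁻¹ * ∫ p, (√(blochSq p) ^ n + (-√(blochSq p)) ^ n) ∂quasiMomentum : ℝ) := by
  rcases Nat.even_or_odd' n with ⟨k, rfl | rfl⟩
  · have h : ∫ p, (√(blochSq p) ^ (2 * k) + (-√(blochSq p)) ^ (2 * k)) ∂quasiMomentum =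
        2 * blochMoment k 0 := by
      rw [blochMoment, ← integral_const_mul]
      refine integral_congr_ae (.of_forall fun p => ?_)
      dsimp only
      rw [pow_mul, pow_mul, neg_sq, Real.sq_sqrt (blochSq_nonneg p)]
      simp
      ring
    rw [h]
    have h' : (2 * Real.pi ^ 2)⁻¹ * (2 * blochMoment k 0) =
        (Real.pi ^ 2)⁻¹ * blochMoment k 0 := by
      field_simp
    rw [h']
    rcases v with γ | γ
    · rw [(honeycombAdjacency_pow_even_delta_a k γ γ).1, sub_self]
    · rw [(honeycombAdjacency_pow_even_delta_b k γ γ).1, sub_self]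
  · have h : ∀ p, √(blochSq p) ^ (2 * k + 1) + (-√(blochSq p)) ^ (2 * k + 1) = 0 := fun p => by
      rw [Odd.neg_pow ⟨k, rfl⟩, add_neg_cancel]
    simp only [h, integral_zero, mul_zero, Complex.ofReal_zero]
    rw [pow_succ']
    change honeycombAdjacency ((honeycombAdjacency ^ (2 * k)) (delta v)) v = 0
    rcases v with γ | γ
    · simp only [honeycombAdjacency_apply_a, (honeycombAdjacency_pow_even_delta_a k _ _).2, add_zero]
    · simp only [honeycombAdjacency_apply_b, (honeycombAdjacency_pow_even_delta_b k _ _).2, add_zero]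

theorem norm_delta {V : Type*} (v : V) : ‖(delta v : EllTwo V)‖ = 1 := by
  classical
  unfold delta
  rw [lp.norm_single (by norm_num)]
  simp

theorem norm_honeycombAdjacency_le : ‖honeycombAdjacency‖ ≤ 3 := by
  unfold honeycombAdjacency adjacencyOp
  exact_mod_cast LinearMap.mkContinuous_norm_le _ (by positivity) _

theorem integrable_comp_sqrt_blochSq {g : ℝ → ℝ} (hg : Continuous g) :
    Integrable (fun p => g (√(blochSq p)) + g (-√(blochSq p))) quasiMomentum :=
  integrable_quasiMomentum_of_continuous (by have := continuous_blochSq; fun_prop)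

/-! ### The spectral measure at a unit vector with Bloch moments -/

/-- `A` is a bounded self-adjoint operator for which the moments of the spectral measure at the
unit vector `x` are those of the density of states of the honeycomb lattice. -/
structure HasBlochMoments {H : Type*} [NormedAddCommGroup H] [InnerProductSpace ℂ H]
    [CompleteSpace H] (A : H →L[ℂ] H) (x : H) : Prop where
  isSelfAdjoint : IsSelfAdjoint A
  norm_le : ‖A‖ ≤ 3
  norm_eq_one : ‖x‖ = 1
  inner_pow : ∀ n : ℕ, ⟪x, (A ^ n) x⟫_ℂ =
    ((2 * Real.pi ^ 2)⁻¹ * ∫ p, (√(blochSq p) ^ n + (-√(blochSq p)) ^ n) ∂quasiMomentum : ℝ)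

namespace HasBlochMoments

variable {H : Type*} [NormedAddCommGroup H] [InnerProductSpace ℂ H] [CompleteSpace H]
  {A : H →L[ℂ] H} {x : H}

theorem inner_aeval (hA : HasBlochMoments A x) (q : Polynomial ℝ) :
    ⟪x, Polynomial.aeval A q x⟫_ℂ = ((2 * Real.pi ^ 2)⁻¹ *
        ∫ p, (q.eval (√(blochSq p)) + q.eval (-√(blochSq p))) ∂quasiMomentum : ℝ) := by
  induction q using Polynomial.induction_on' with
  | add q r hq hr =>
    have h1 := integrable_comp_sqrt_blochSq (g := fun x => q.eval x) q.continuous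
    have h2 := integrable_comp_sqrt_blochSq (g := fun x => r.eval x) r.continuous
    have h3 : ∫ p, ((q + r).eval (√(blochSq p)) + (q + r).eval (-√(blochSq p))) ∂quasiMomentum =
        ∫ p, (q.eval (√(blochSq p)) + q.eval (-√(blochSq p))) ∂quasiMomentum +
          ∫ p, (r.eval (√(blochSq p)) + r.eval (-√(blochSq p))) ∂quasiMomentum := by
      rw [← integral_add h1 h2]
      refine integral_congr_ae (.of_forall fun p => ?_)
      simp only [Polynomial.eval_add]
      ring
    rw [h3, map_add, mul_add, Complex.ofReal_add, ← hq, ← hr, ← inner_add_right]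
    rfl
  | monomial n c =>
    have h3 : ∫ p, ((Polynomial.monomial n c).eval (√(blochSq p)) +
        (Polynomial.monomial n c).eval (-√(blochSq p))) ∂quasiMomentum =
        c * ∫ p, (√(blochSq p) ^ n + (-√(blochSq p)) ^ n) ∂quasiMomentum := by
      rw [← integral_const_mul]
      refine integral_congr_ae (.of_forall fun p => ?_)
      simp only [Polynomial.eval_monomial]
      ring
    rw [h3, Polynomial.aeval_monomial, mul_left_comm, Complex.ofReal_mul,
      ← hA.inner_pow, ← Algebra.smul_def, ← Complex.coe_smul, _root_.smul_apply,
      inner_smul_right]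

/-- The spectral measure of `A` at `x` is the density of states measure. -/
theorem inner_cfc (hA : HasBlochMoments A x) {g : ℝ → ℝ} (hg : Continuous g) :
    ⟪x, cfc g A x⟫_ℂ = ((2 * Real.pi ^ 2)⁻¹ *
        ∫ p, (g (√(blochSq p)) + g (-√(blochSq p))) ∂quasiMomentum : ℝ) := by
  have : Nontrivial H := ⟨x, 0, fun h => by simpa [h] using hA.norm_eq_one⟩
  rw [← sub_eq_zero, ← norm_le_zero_iff]
  refine le_of_forall_pos_le_add fun ε hε => ?_
  -- The interval `[-3, 3]` contains both the spectrum of `A` and all values `±√blochSq`, so one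
  -- polynomial controls both sides.
  obtain ⟨q, hq⟩ := exists_polynomial_near_of_continuousOn (-3) 3 g hg.continuousOn (ε / 2)
    (by positivity)
  have hspec : ∀ x ∈ spectrum ℝ A, x ∈ Set.Icc (-3 : ℝ) 3 := fun x hx => by
    have h1 := spectrum.norm_le_norm_of_mem hx
    exact abs_le.1 (h1.trans hA.norm_le)
  have h1 : ‖Polynomial.aeval A q - cfc g A‖ ≤ ε / 2 := by
    rw [← cfc_polynomial q A hA.isSelfAdjoint,
      ← cfc_sub _ _ A q.continuous.continuousOn hg.continuousOn]
    exact norm_cfc_le (by positivity) fun x hx => (hq x (hspec x hx)).le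
  have h2 : ‖⟪x, (Polynomial.aeval A q - cfc g A) x⟫_ℂ‖ ≤ ε / 2 := by
    refine (norm_inner_le_norm _ _).trans ?_
    rw [hA.norm_eq_one, one_mul]
    refine (ContinuousLinearMap.le_opNorm _ _).trans ?_
    rwa [hA.norm_eq_one, mul_one]
  rw [_root_.sub_apply, inner_sub_right, hA.inner_aeval] at h2
  set I := ∫ p, (g (√(blochSq p)) + g (-√(blochSq p))) ∂quasiMomentum
  set J := ∫ p, (q.eval (√(blochSq p)) + q.eval (-√(blochSq p))) ∂quasiMomentum
  -- Two terms, each off by at most `ε / 2`, over total mass `π²`; the prefactor `(2π²)⁻¹` turns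
  -- this into `ε / 2`.
  have hJI : |J - I| ≤ ε * Real.pi ^ 2 := by
    have h4 : J - I = ∫ p, ((q.eval (√(blochSq p)) + q.eval (-√(blochSq p))) -
        (g (√(blochSq p)) + g (-√(blochSq p)))) ∂quasiMomentum :=
      (integral_sub (integrable_comp_sqrt_blochSq (g := fun x => q.eval x) q.continuous)
        (integrable_comp_sqrt_blochSq hg)).symm
    rw [h4, ← quasiMomentum_real_univ, ← Real.norm_eq_abs]
    refine norm_integral_le_of_norm_le_const (.of_forall fun p => ?_)
    have h5 := Real.sqrt_nonneg (blochSq p)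
    have h6 := sqrt_blochSq_le p
    have h7 := hq (√(blochSq p)) ⟨by linarith, h6⟩
    have h8 := hq (-√(blochSq p)) ⟨by linarith, by linarith⟩
    rw [abs_lt] at h7 h8
    rw [Real.norm_eq_abs, abs_le]
    constructor <;> linarith
  have h9 : ‖(((2 * Real.pi ^ 2)⁻¹ * J : ℝ) : ℂ) - (((2 * Real.pi ^ 2)⁻¹ * I : ℝ) : ℂ)‖ ≤
      ε / 2 := by
    rw [← Complex.ofReal_sub, Complex.norm_real, ← mul_sub, norm_mul, Real.norm_eq_abs (J - I),
      Real.norm_of_nonneg (by positivity), inv_mul_le_iff₀ (by positivity)]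
    linarith
  have h10 := norm_sub_le_norm_sub_add_norm_sub ⟪x, cfc g A x⟫_ℂ
    (((2 * Real.pi ^ 2)⁻¹ * J : ℝ) : ℂ) (((2 * Real.pi ^ 2)⁻¹ * I : ℝ) : ℂ)
  rw [norm_sub_rev] at h2
  linarith

end HasBlochMoments

theorem tendsto_one_div_one_add_mul {y : ℝ} (hy : 0 ≤ y) :
    Tendsto (fun n : ℕ => 1 / (1 + n * y)) atTop (𝓝 (if y = 0 then 1 else 0)) := by
  split_ifs with h
  · simp [h]
  · have h1 : 0 < y := lt_of_le_of_ne hy (Ne.symm h)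
    refine Tendsto.const_div_atTop ?_ 1
    exact tendsto_const_nhds.add_atTop (tendsto_natCast_atTop_atTop.atTop_mul_const h1)

namespace HasBlochMoments

variable {H : Type*} [NormedAddCommGroup H] [InnerProductSpace ℂ H] [CompleteSpace H]
  {A : H →L[ℂ] H} {x : H}

/-- The quadratic form at `x` of the orthogonal projection onto the kernel of `f(A)`. -/
theorem inner_starProjection_ker_cfc (hA : HasBlochMoments A x) {f : ℝ → ℝ} (hf : Continuous f)
    (h0 : ∀ x, 0 ≤ f x) (K : Submodule ℂ H) [K.HasOrthogonalProjection]
    (hK : K = LinearMap.ker (cfc f A).toLinearMap) :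
    ⟪x, K.starProjection x⟫_ℂ =
      ((2 * Real.pi ^ 2)⁻¹ * (quasiMomentum.real {p | f (√(blochSq p)) = 0} +
        quasiMomentum.real {p | f (-√(blochSq p)) = 0}) : ℝ) := by
  have hpos : ∀ (n : ℕ) y, 0 < 1 + n * f y := fun n y => by
    have := h0 y
    positivity
  have hcont : ∀ n : ℕ, Continuous fun y => 1 / (1 + n * f y) := fun n =>
    continuous_const.div (by fun_prop) fun y => (hpos n y).ne'
  have h1 := tendsto_cfc_one_div_starProjection_ker hA.isSelfAdjoint hf h0 K hK x
  have h2 : Tendsto (fun n : ℕ => ⟪x, cfc (fun y => 1 / (1 + n * f y)) A x⟫_ℂ) atTop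
      (𝓝 ⟪x, K.starProjection x⟫_ℂ) := tendsto_const_nhds.inner h1
  simp only [hA.inner_cfc (hcont _)] at h2
  refine tendsto_nhds_unique h2 ?_
  refine (Complex.continuous_ofReal.tendsto _).comp (Tendsto.const_mul _ ?_)
  have hm : ∀ {φ : ℝ × ℝ → ℝ}, Continuous φ → MeasurableSet {p | f (φ p) = 0} := fun hφ =>
    (isClosed_eq (hf.comp hφ) continuous_const).measurableSet
  have hs : Continuous fun p => √(blochSq p) := continuous_blochSq.sqrt
  have hs' : Continuous fun p => -√(blochSq p) := hs.neg
  have h3 : quasiMomentum.real {p | f (√(blochSq p)) = 0} +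
      quasiMomentum.real {p | f (-√(blochSq p)) = 0} =
      ∫ p, ((if f (√(blochSq p)) = 0 then (1 : ℝ) else 0) +
        if f (-√(blochSq p)) = 0 then (1 : ℝ) else 0) ∂quasiMomentum := by
    rw [← integral_indicator_one (hm hs), ← integral_indicator_one (hm hs'), ← integral_add]
    · refine integral_congr_ae (.of_forall fun p => ?_)
      simp [Set.indicator_apply]
    · exact (integrable_const (1 : ℝ)).indicator (hm hs)
    · exact (integrable_const (1 : ℝ)).indicator (hm hs')
  rw [h3]
  -- Each of the two summands lies in `[0, 1]` and tends to the indicator of `f = 0`.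
  refine tendsto_integral_of_dominated_convergence (fun _ => 2) (fun n => ?_)
    (integrable_const _) (fun n => .of_forall fun p => ?_) (.of_forall fun p => ?_)
  · exact (integrable_comp_sqrt_blochSq (hcont n)).aestronglyMeasurable
  · have h4 : ∀ y, 1 / (1 + n * f y) ≤ 1 := fun y => by
      rw [div_le_one (hpos n y)]
      have := h0 y
      have : 0 ≤ n * f y := by positivity
      linarith
    have h5 : ∀ y, 0 ≤ 1 / (1 + n * f y) := fun y => by
      have := hpos n y
      positivity
    rw [Real.norm_of_nonneg (add_nonneg (h5 _) (h5 _))]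
    linarith [h4 (√(blochSq p)), h4 (-√(blochSq p))]
  · exact (tendsto_one_div_one_add_mul (h0 _)).add (tendsto_one_div_one_add_mul (h0 _))

/-- The spectral function of `1 - A / 3` at `x`. -/
theorem inner_spectralProjector (hA : HasBlochMoments A x) (E : ℝ) :
    ⟪x, spectralProjector (1 - ((3 : ℝ)⁻¹) • A) E x⟫_ℂ =
      ((2 * Real.pi ^ 2)⁻¹ * (quasiMomentum.real {p | 3 * (1 - E) ≤ √(blochSq p)} +
        quasiMomentum.real {p | √(blochSq p) ≤ -(3 * (1 - E))}) : ℝ) := by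
  have hT : 1 - ((3 : ℝ)⁻¹) • A = cfc (fun y : ℝ => 1 - (3 : ℝ)⁻¹ * y) A := by
    rw [cfc_sub (a := A) (fun _ => 1) (fun y : ℝ => (3 : ℝ)⁻¹ * y),
      cfc_const_one ℝ A hA.isSelfAdjoint, cfc_const_mul_id (3 : ℝ)⁻¹ A hA.isSelfAdjoint]
  have hcomp : cfc (fun y : ℝ => max (y - E) 0) (1 - ((3 : ℝ)⁻¹) • A) =
      cfc (fun y : ℝ => max (1 - (3 : ℝ)⁻¹ * y - E) 0) A := by
    rw [hT, ← cfc_comp (fun y : ℝ => max (y - E) 0) (fun y : ℝ => 1 - (3 : ℝ)⁻¹ * y) A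
      hA.isSelfAdjoint]
    rfl
  unfold spectralProjector
  have : CompleteSpace (LinearMap.ker
      (cfc (fun y : ℝ => max (y - E) 0) (1 - ((3 : ℝ)⁻¹) • A)).toLinearMap) :=
    (ContinuousLinearMap.isClosed_ker _).completeSpace_coe
  rw [hA.inner_starProjection_ker_cfc (f := fun y : ℝ => max (1 - (3 : ℝ)⁻¹ * y - E) 0)
    (by fun_prop) (fun _ => le_max_right _ _) _ (by rw [hcomp])]
  congr 4 <;>
  · ext p
    simp only [Set.mem_ofPred_eq, max_eq_right_iff]
    constructor <;> intro <;> linarith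

/-- Eigenvectors of `A` are orthogonal to `x`. -/
theorem inner_eigenvector_eq_zero (hA : HasBlochMoments A x) {y : H} {μ : ℝ}
    (hy : A y = (μ : ℂ) • y) : ⟪x, y⟫_ℂ = 0 := by
  -- The projection formula requires a nonnegative function. Since `B² = (A - μ)²` and `B` is
  -- self-adjoint, the eigenvector `y` lies in `ker B`.
  set B := cfc (fun t : ℝ => |t - μ|) A with hB
  have : CompleteSpace (LinearMap.ker B.toLinearMap) := B.isClosed_ker.completeSpace_coe
  set K := LinearMap.ker B.toLinearMap with hK
  have hBsa : IsSelfAdjoint B := cfc_predicate _ A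
  have hBB : B * B = (A - μ • (1 : H →L[ℂ] H)) * (A - μ • (1 : H →L[ℂ] H)) := by
    have h1 : A - μ • (1 : H →L[ℂ] H) = cfc (fun t : ℝ => t - μ) A := by
      rw [cfc_sub (a := A) (fun t : ℝ => t) (fun _ => μ), cfc_id' ℝ A hA.isSelfAdjoint,
        cfc_const μ A hA.isSelfAdjoint, Algebra.algebraMap_eq_smul_one]
    rw [h1, hB, ← cfc_mul _ _ A, ← cfc_mul _ _ A]
    exact cfc_congr fun t _ => abs_mul_abs_self _
  have hyK : y ∈ K := by
    have h2 : (A - μ • (1 : H →L[ℂ] H)) y = 0 := by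
      rw [_root_.sub_apply, hy, sub_eq_zero, Complex.coe_smul]
      rfl
    have h3 : B (B y) = 0 := by
      change (B * B) y = 0
      rw [hBB]
      change (A - μ • (1 : H →L[ℂ] H)) ((A - μ • (1 : H →L[ℂ] H)) y) = 0
      rw [h2, map_zero]
    change B y = 0
    rw [← inner_self_eq_zero (𝕜 := ℂ)]
    have h4 := ContinuousLinearMap.adjoint_inner_right B (B y) y
    rw [hBsa.adjoint_eq] at h4
    rw [← ContinuousLinearMap.adjoint_inner_left, hBsa.adjoint_eq, h3, inner_zero_left]
  have h5 := hA.inner_starProjection_ker_cfc (f := fun t : ℝ => |t - μ|) (by fun_prop)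
    (fun _ => abs_nonneg _) K rfl
  have h6 : quasiMomentum.real {p | |√(blochSq p) - μ| = 0} = 0 := by
    refine le_antisymm ?_ measureReal_nonneg
    refine (measureReal_mono fun p hp => ?_).trans_eq (quasiMomentum_real_blochSq_eq (μ ^ 2))
    simp only [Set.mem_ofPred_eq, abs_eq_zero, sub_eq_zero] at hp ⊢
    rw [← hp, Real.sq_sqrt (blochSq_nonneg p)]
  have h7 : quasiMomentum.real {p | |-√(blochSq p) - μ| = 0} = 0 := by
    refine le_antisymm ?_ measureReal_nonneg
    refine (measureReal_mono fun p hp => ?_).trans_eq (quasiMomentum_real_blochSq_eq (μ ^ 2))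
    simp only [Set.mem_ofPred_eq, abs_eq_zero, sub_eq_zero] at hp ⊢
    rw [← hp, neg_sq, Real.sq_sqrt (blochSq_nonneg p)]
  rw [h6, h7, add_zero, mul_zero, Complex.ofReal_zero] at h5
  -- The quadratic form of an orthogonal projection at `x` is the squared norm of the projected
  -- vector.
  have h8 : K.starProjection x = 0 := by
    rw [← inner_self_eq_zero (𝕜 := ℂ), K.inner_starProjection_left_eq_right,
      K.starProjection_eq_self_iff.2 (K.starProjection_apply_mem x)]
    exact h5
  rw [← K.starProjection_eq_self_iff.2 hyK, ← K.inner_starProjection_left_eq_right, h8,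
    inner_zero_left]

end HasBlochMoments

/-! ### Areas of level regions as integrals of `honeycombIntegrand` -/

open PeriodicGraph HoneycombVertex

theorem intervalIntegrable_and_quasiMomentum_real_le_blochSq {E : ℝ} (h0 : 0 ≤ E)
    (h1 : E ≤ 2 / 3) :
    IntervalIntegrable (honeycombIntegrand E) volume (1 - 3 / 2 * E) 1 ∧
      quasiMomentum.real {p | 9 * (1 - E) ^ 2 ≤ blochSq p} =
        2 * ∫ t in (1 - 3 / 2 * E)..1, honeycombIntegrand E t := by
  set F : ℝ → ℝ := fun t => Real.arccos ((9 * (1 - E) ^ 2 - 1) / (4 * t) - t) with hF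
  have hint : IntegrableOn (fun α => F (Real.cos α)) (Set.Icc 0 Real.pi) :=
    integrableOn_arccos (by fun_prop)
  obtain ⟨hI, hS⟩ := integrableOn_div_sqrt_and_integral (f := F) (a := 1 - 3 / 2 * E) (b := 1)
    (by linarith) (by linarith) le_rfl hint
  refine ⟨hI, ?_⟩
  change _ = 2 * ∫ t in (1 - 3 / 2 * E)..1, F t / √(1 - t ^ 2)
  rw [hS, Real.arccos_one, quasiMomentum_real_eq_integral
    (measurableSet_le measurable_const measurable_blochSq)]
  have hslice : ∫ α, halfPeriod.real (Prod.mk α ⁻¹' {p | 9 * (1 - E) ^ 2 ≤ blochSq p})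
      ∂halfPeriod = ∫ α, F |Real.cos α| ∂halfPeriod := by
    refine integral_congr_ae ?_
    filter_upwards [ae_cos_ne_zero] with α hα
    exact halfPeriod_real_le_blochSq _ hα
  rw [hslice, integral_halfPeriod]
  refine integral_symm_eq_two_mul hint (fun α => by rw [Real.cos_pi_sub, abs_neg]) le_rfl
    (Real.arccos_nonneg _) (Real.arccos_le_pi_div_two.2 (by linarith)) (fun α hα => ?_)
    (fun α hα => absurd (hα.1.trans hα.2) (lt_irrefl _)) (fun α hα => ?_)
  -- It remains to see where the arccosine vanishes. For `t > 0` its argument is at least `1` iff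
  -- `(2t + 1)² ≤ 9(1 - E)²`, that is, iff `t ≤ 1 - 3E/2`; hence the lower limit.
  · rw [abs_of_pos (Real.cos_pos_of_mem_Ioo ⟨by linarith [hα.1, Real.pi_pos], hα.2⟩)]
  · have h2 : 0 < Real.cos α := Real.cos_pos_of_mem_Ioo
      ⟨by linarith [hα.1, Real.arccos_nonneg (1 - 3 / 2 * E), Real.pi_pos], hα.2⟩
    have h3 : Real.cos α < 1 - 3 / 2 * E := by
      rw [← Real.cos_arccos (x := 1 - 3 / 2 * E) (by linarith) (by linarith)]
      exact Real.cos_lt_cos_of_nonneg_of_le_pi (Real.arccos_nonneg _)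
        (by linarith [hα.2, Real.pi_pos]) hα.1
    refine Real.arccos_of_one_le ?_
    rw [le_sub_iff_add_le, le_div_iff₀ (by linarith)]
    nlinarith

theorem intervalIntegrable_and_quasiMomentum_real_blochSq_le {E : ℝ} (h0 : 2 / 3 ≤ E)
    (h1 : E ≤ 1) :
    IntervalIntegrable (honeycombIntegrand E) volume (-2 + 3 / 2 * E) (1 - 3 / 2 * E) ∧
      quasiMomentum.real {p | blochSq p ≤ 9 * (1 - E) ^ 2} =
        2 * ∫ t in (-2 + 3 / 2 * E)..(1 - 3 / 2 * E), honeycombIntegrand E t := by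
  set F : ℝ → ℝ := fun t => Real.arccos ((9 * (1 - E) ^ 2 - 1) / (4 * t) - t) with hF
  have hint : IntegrableOn (fun α => F (Real.cos α)) (Set.Icc 0 Real.pi) :=
    integrableOn_arccos (by fun_prop)
  have hint' : IntegrableOn (fun α => F (-Real.cos α)) (Set.Icc 0 Real.pi) :=
    integrableOn_arccos (by fun_prop)
  obtain ⟨hI, hS⟩ := integrableOn_div_sqrt_and_integral (f := F) (a := -2 + 3 / 2 * E)
    (b := 1 - 3 / 2 * E) (by linarith) (by linarith) (by linarith) hint
  refine ⟨hI, ?_⟩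
  change _ = 2 * ∫ t in (-2 + 3 / 2 * E)..(1 - 3 / 2 * E), F t / √(1 - t ^ 2)
  -- The interval of `t` lies in `[-1, 0]`, that is, `α ≥ π / 2`; the reflection `α ↦ π - α` moves
  -- it to the first half.
  have hrefl : ∫ α in (Real.arccos (1 - 3 / 2 * E))..(Real.arccos (-2 + 3 / 2 * E)),
      F (Real.cos α) =
      ∫ α in (Real.arccos (2 - 3 / 2 * E))..(Real.arccos (3 / 2 * E - 1)), F (-Real.cos α) := by
    rw [show 1 - 3 / 2 * E = -(3 / 2 * E - 1) by ring,
      show -2 + 3 / 2 * E = -(2 - 3 / 2 * E) by ring, Real.arccos_neg, Real.arccos_neg,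
      ← intervalIntegral.integral_comp_sub_left (fun α => F (Real.cos α))]
    simp only [Real.cos_pi_sub]
  rw [hS, hrefl, quasiMomentum_real_eq_integral
    (measurableSet_le measurable_blochSq measurable_const)]
  have hslice : ∫ α, halfPeriod.real (Prod.mk α ⁻¹' {p | blochSq p ≤ 9 * (1 - E) ^ 2})
      ∂halfPeriod = ∫ α, F (-|Real.cos α|) ∂halfPeriod := by
    refine integral_congr_ae ?_
    filter_upwards [ae_cos_ne_zero] with α hα
    exact halfPeriod_real_blochSq_le _ hα
  rw [hslice, integral_halfPeriod]
  -- At `-t` the argument is at least `1` iff `9(1 - E)² ≤ (2t - 1)²`. The roots `t = (1 ± 3(1 - E))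
  -- / 2` are the two endpoints.
  have hzero : ∀ t : ℝ, 0 < t → (t < 3 / 2 * E - 1 ∨ 2 - 3 / 2 * E < t) → F (-t) = 0 := by
    intro t ht ht'
    refine Real.arccos_of_one_le ?_
    rw [le_sub_iff_add_le, le_div_iff_of_neg (by linarith)]
    rcases ht' with h | h <;> nlinarith
  refine integral_symm_eq_two_mul hint' (fun α => by rw [Real.cos_pi_sub, abs_neg])
    (Real.arccos_nonneg _) (Real.antitone_arccos (by linarith))
    (Real.arccos_le_pi_div_two.2 (by linarith)) (fun α hα => ?_) (fun α hα => ?_) (fun α hα => ?_)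
  · rw [abs_of_pos (Real.cos_pos_of_mem_Ioo ⟨by linarith [hα.1, Real.pi_pos], hα.2⟩)]
  · have h4 : Real.arccos (2 - 3 / 2 * E) ≤ Real.pi / 2 :=
      Real.arccos_le_pi_div_two.2 (by linarith)
    refine hzero _ (Real.cos_pos_of_mem_Ioo ⟨by linarith [hα.1, Real.pi_pos],
      by linarith [hα.2]⟩) (.inr ?_)
    rw [← Real.cos_arccos (x := 2 - 3 / 2 * E) (by linarith) (by linarith)]
    exact Real.cos_lt_cos_of_nonneg_of_le_pi hα.1.le (Real.arccos_le_pi _) hα.2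
  · have h4 := Real.arccos_nonneg (3 / 2 * E - 1)
    refine hzero _ (Real.cos_pos_of_mem_Ioo ⟨by linarith [hα.1, Real.pi_pos], hα.2⟩) (.inl ?_)
    rw [← Real.cos_arccos (x := 3 / 2 * E - 1) (by linarith) (by linarith)]
    exact Real.cos_lt_cos_of_nonneg_of_le_pi h4 (by linarith [hα.2, Real.pi_pos]) hα.1

/-! ### The integrated density of states and the absence of eigenvalues -/

theorem hasBlochMoments_delta (v : HoneycombVertex) :
    HasBlochMoments honeycombAdjacency (delta v) where
  isSelfAdjoint := by
    have h : honeycombAdjacency = (3 : ℂ) • (1 - honeycombLaplacian) := by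
      have h1 : honeycombLaplacian = 1 - ((3 : ℂ)⁻¹) • honeycombAdjacency := rfl
      rw [h1, sub_sub_cancel, smul_smul]
      norm_num
    rw [h]
    refine IsSelfAdjoint.smul (by simp) ?_
    exact (IsSelfAdjoint.one _).sub (laplacian_isSelfAdjoint _ _)
  norm_le := norm_honeycombAdjacency_le
  norm_eq_one := norm_delta v
  inner_pow n := by rw [inner_delta, honeycombAdjacency_pow_delta_self]

theorem honeycombLaplacian_eq :
    honeycombLaplacian = 1 - ((3 : ℝ)⁻¹) • honeycombAdjacency := by
  ext f v
  have h : honeycombLaplacian f v = f v - (3 : ℂ)⁻¹ * honeycombAdjacency f v := rfl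
  have h' : (1 - ((3 : ℝ)⁻¹) • honeycombAdjacency) f v =
    f v - (3 : ℝ)⁻¹ • honeycombAdjacency f v := rfl
  rw [h, h', Complex.real_smul]
  norm_num

theorem trace_cutoff_comp {V : Type*} (Q : Finset V) (S : EllTwo V →L[ℂ] EllTwo V) :
    trace (cutoff Q ∘L S) = ∑ v ∈ Q, ⟪delta v, S (delta v)⟫_ℂ := by
  classical
  have h : ∀ w, ⟪delta w, (cutoff Q ∘L S) (delta w)⟫_ℂ =
      if w ∈ Q then ⟪delta w, S (delta w)⟫_ℂ else 0 := fun w => by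
    simp only [cutoff, ContinuousLinearMap.comp_apply, _root_.sum_apply,
      InnerProductSpace.rankOne_apply, inner_sum, inner_smul_right, inner_delta, delta_apply]
    simp
  rw [trace, tsum_congr h, tsum_eq_sum (s := Q) (fun w hw => if_neg hw)]
  exact Finset.sum_congr rfl fun w hw => if_pos hw

/-- Both vertices of the fundamental domain contribute the same amount, so the sum over `Q` cancels
the factor `1 / |Q|`. -/
theorem honeycombIDS_eq (E : ℝ) :
    honeycombIDS E = (2 * Real.pi ^ 2)⁻¹ *
      (quasiMomentum.real {p | 3 * (1 - E) ≤ √(blochSq p)} +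
        quasiMomentum.real {p | √(blochSq p) ≤ -(3 * (1 - E))}) := by
  have h : ∀ v, ⟪delta v, spectralProjector honeycombLaplacian E (delta v)⟫_ℂ =
      ((2 * Real.pi ^ 2)⁻¹ * (quasiMomentum.real {p | 3 * (1 - E) ≤ √(blochSq p)} +
        quasiMomentum.real {p | √(blochSq p) ≤ -(3 * (1 - E))}) : ℝ) := fun v => by
    rw [honeycombLaplacian_eq]
    exact (hasBlochMoments_delta v).inner_spectralProjector E
  have h2 : (fundamentalDomain.card : ℝ) = 2 := by simp [fundamentalDomain]
  rw [honeycombIDS, ids, trace_cutoff_comp]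
  change 1 / (fundamentalDomain.card : ℝ) * (∑ v ∈ fundamentalDomain,
    ⟪delta v, spectralProjector honeycombLaplacian E (delta v)⟫_ℂ).re = _
  simp only [h, Finset.sum_const, nsmul_eq_mul]
  rw [← Complex.ofReal_natCast, ← Complex.ofReal_mul, Complex.ofReal_re, h2]
  ring

theorem measurable_sqrt_blochSq : Measurable fun p => √(blochSq p) :=
  measurable_blochSq.sqrt

/-- Up to the factor `π²`, the integrated density of `√(blochSq)` is continuous, so that weak and
strict sublevel sets have complementary measures. -/
theorem quasiMomentum_real_le_add_real_ge (c : ℝ) :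
    quasiMomentum.real {p | √(blochSq p) ≤ c} + quasiMomentum.real {p | c ≤ √(blochSq p)} =
      Real.pi ^ 2 := by
  have h1 : quasiMomentum.real {p | c ≤ √(blochSq p)} =
      quasiMomentum.real {p | √(blochSq p) ≤ c}ᶜ := by
    refine le_antisymm ?_ (measureReal_mono fun p hp => ?_)
    · have h2 : quasiMomentum.real {p | √(blochSq p) ≤ c}ᶜ =
          quasiMomentum.real {p | √(blochSq p) ≤ c}ᶜ +
            quasiMomentum.real {p | blochSq p = c ^ 2} := by
        rw [quasiMomentum_real_blochSq_eq, add_zero]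
      rw [h2]
      refine (measureReal_mono fun p hp => ?_).trans (measureReal_union_le _ _)
      rcases (show c ≤ √(blochSq p) from hp).lt_or_eq with h | h
      · exact .inl (not_le.2 h)
      · right
        change blochSq p = c ^ 2
        rw [h, Real.sq_sqrt (blochSq_nonneg p)]
    · have h : ¬ √(blochSq p) ≤ c := hp
      exact (not_le.1 h).le
  rw [h1, measureReal_add_measureReal_compl
    (measurableSet_le measurable_sqrt_blochSq measurable_const), quasiMomentum_real_univ]

/-- The reflection `E ↦ 2 - E` negates the threshold `3(1 - E)`. The four regions then pair up into
two complementary pairs, of total area `2π²`. -/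
theorem honeycombIDS_two_sub (E : ℝ) : honeycombIDS (2 - E) = 1 - honeycombIDS E := by
  have h1 := quasiMomentum_real_le_add_real_ge (3 * (1 - E))
  have h2 := quasiMomentum_real_le_add_real_ge (-(3 * (1 - E)))
  rw [honeycombIDS_eq, honeycombIDS_eq, show 3 * (1 - (2 - E)) = -(3 * (1 - E)) by ring, neg_neg,
    eq_sub_iff_add_eq, ← mul_add, inv_mul_eq_one₀ (by positivity)]
  linarith

/-- Below the band centre only the lower band contributes. -/
theorem honeycombIDS_of_le_one {E : ℝ} (hE : E ≤ 1) :
    honeycombIDS E = (2 * Real.pi ^ 2)⁻¹ *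
      quasiMomentum.real {p | 9 * (1 - E) ^ 2 ≤ blochSq p} := by
  have h1 : {p | 3 * (1 - E) ≤ √(blochSq p)} = {p | 9 * (1 - E) ^ 2 ≤ blochSq p} := by
    ext p
    simp only [Set.mem_ofPred_eq]
    rw [Real.le_sqrt (by linarith) (blochSq_nonneg p), mul_pow]
    norm_num
  have h2 : quasiMomentum.real {p | √(blochSq p) ≤ -(3 * (1 - E))} = 0 := by
    refine le_antisymm ?_ measureReal_nonneg
    refine (measureReal_mono fun p hp => ?_).trans_eq (quasiMomentum_real_blochSq_eq 0)
    have h3 : √(blochSq p) ≤ -(3 * (1 - E)) := hp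
    have h4 : √(blochSq p) = 0 := le_antisymm (by linarith) (Real.sqrt_nonneg _)
    exact (Real.sqrt_eq_zero (blochSq_nonneg p)).1 h4
  rw [honeycombIDS_eq, h1, h2, add_zero]

/-- The region lies in the null set where the symbol attains its bound `9`. Including `E = 0`
supplies, by reflection, the value at `E = 2`. -/
theorem honeycombIDS_of_nonpos {E : ℝ} (hE : E ≤ 0) : honeycombIDS E = 0 := by
  have h : quasiMomentum.real {p | 9 * (1 - E) ^ 2 ≤ blochSq p} = 0 := by
    refine le_antisymm ?_ measureReal_nonneg
    refine (measureReal_mono fun p hp => ?_).trans_eq (quasiMomentum_real_blochSq_eq 9)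
    have h3 : 9 * (1 - E) ^ 2 ≤ blochSq p := hp
    exact le_antisymm (blochSq_le p) (by nlinarith)
  rw [honeycombIDS_of_le_one (by linarith), h, mul_zero]

theorem honeycombIDS_lower {E : ℝ} (h0 : 0 ≤ E) (h1 : E ≤ 2 / 3) :
    honeycombIDS E = 1 / Real.pi ^ 2 * ∫ t in (1 - 3 / 2 * E)..1, honeycombIntegrand E t := by
  rw [honeycombIDS_of_le_one (by linarith),
    (intervalIntegrable_and_quasiMomentum_real_le_blochSq h0 h1).2]
  field_simp

/-- The area is computed through the complementary region around the zero of the symbol; the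
constant `1 / 2` is the full weight of the lower band. -/
theorem honeycombIDS_middle {E : ℝ} (h0 : 2 / 3 ≤ E) (h1 : E ≤ 1) :
    honeycombIDS E = 1 / 2 - 1 / Real.pi ^ 2 *
      ∫ t in (-2 + 3 / 2 * E)..(1 - 3 / 2 * E), honeycombIntegrand E t := by
  have h2 := quasiMomentum_real_le_add_real_ge (3 * (1 - E))
  have h3 : {p | √(blochSq p) ≤ 3 * (1 - E)} = {p | blochSq p ≤ 9 * (1 - E) ^ 2} := by
    ext p
    simp only [Set.mem_ofPred_eq]
    rw [Real.sqrt_le_left (by linarith), mul_pow]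
    norm_num
  have h4 : {p | 3 * (1 - E) ≤ √(blochSq p)} = {p | 9 * (1 - E) ^ 2 ≤ blochSq p} := by
    ext p
    simp only [Set.mem_ofPred_eq]
    rw [Real.le_sqrt (by linarith) (blochSq_nonneg p), mul_pow]
    norm_num
  rw [h3, h4, (intervalIntegrable_and_quasiMomentum_real_blochSq_le h0 h1).2] at h2
  rw [honeycombIDS_of_le_one h1, eq_sub_iff_add_eq'.2 h2]
  field_simp

theorem honeycombIntegrand_two_sub (E : ℝ) : honeycombIntegrand (2 - E) = honeycombIntegrand E := by
  ext t
  unfold honeycombIntegrand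
  rw [show (1 - (2 - E)) ^ 2 = (1 - E) ^ 2 by ring]

/-- Symmetry makes an eigenvalue real. An eigenfunction of `Δ` is one of `A`, hence orthogonal to
every `δ_v`, so all its values vanish. -/
theorem not_hasEigenvalue_honeycombLaplacian (z : ℂ) :
    ¬ Module.End.HasEigenvalue honeycombLaplacian.toLinearMap z := by
  intro hz
  have hsymm : honeycombLaplacian.toLinearMap.IsSymmetric :=
    (ContinuousLinearMap.isSelfAdjoint_iff_isSymmetric).1 (laplacian_isSelfAdjoint _ _)
  obtain ⟨r, rfl⟩ := Complex.conj_eq_iff_real.1 (hsymm.conj_eigenvalue_eq_self hz)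
  obtain ⟨f, hf⟩ := hz.exists_hasEigenvector
  apply hf.2
  have hA : honeycombAdjacency f = ((3 * (1 - r) : ℝ) : ℂ) • f := by
    ext v
    have h1 : honeycombLaplacian f = (r : ℂ) • f := hf.apply_eq_smul
    have h2 : f v - (3 : ℂ)⁻¹ * honeycombAdjacency f v = r * f v :=
      congrArg (fun g : EllTwo HoneycombVertex => g v) h1
    have h3 : (((3 * (1 - r) : ℝ) : ℂ) • f) v = ((3 * (1 - r) : ℝ) : ℂ) * f v := rfl
    rw [h3]
    push_cast
    linear_combination (-3) * h2
  ext v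
  rw [← inner_delta v f]
  exact (hasBlochMoments_delta v).inner_eigenvector_eq_zero hA

theorem mainTheorem6 :
    (∀ E : ℝ, E < 0 → honeycombIDS E = 0) ∧
    (∀ E : ℝ, 0 ≤ E → E < 2 / 3 →
      IntervalIntegrable (honeycombIntegrand E) volume (1 - 3 / 2 * E) 1 ∧
      honeycombIDS E = 1 / Real.pi ^ 2 * ∫ t in (1 - 3 / 2 * E)..1, honeycombIntegrand E t) ∧
    (∀ E : ℝ, 2 / 3 ≤ E → E < 1 →
      IntervalIntegrable (honeycombIntegrand E) volume (-2 + 3 / 2 * E) (1 - 3 / 2 * E) ∧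
      honeycombIDS E = 1 / 2 - 1 / Real.pi ^ 2 *
        ∫ t in (-2 + 3 / 2 * E)..(1 - 3 / 2 * E), honeycombIntegrand E t) ∧
    (∀ E : ℝ, 1 ≤ E → E < 4 / 3 →
      IntervalIntegrable (honeycombIntegrand E) volume (1 - 3 / 2 * E) (-2 + 3 / 2 * E) ∧
      honeycombIDS E = 1 / 2 + 1 / Real.pi ^ 2 *
        ∫ t in (1 - 3 / 2 * E)..(-2 + 3 / 2 * E), honeycombIntegrand E t) ∧
    (∀ E : ℝ, 4 / 3 ≤ E → E < 2 →
      IntervalIntegrable (honeycombIntegrand E) volume (-2 + 3 / 2 * E) 1 ∧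
      honeycombIDS E = 1 - 1 / Real.pi ^ 2 *
        ∫ t in (-2 + 3 / 2 * E)..1, honeycombIntegrand E t) ∧
    (∀ E : ℝ, 2 ≤ E → honeycombIDS E = 1) ∧
    (∀ E : ℝ, honeycombIDS (2 - E) = 1 - honeycombIDS E) ∧
    (∀ z : ℂ, ¬ Module.End.HasEigenvalue honeycombLaplacian.toLinearMap z) := by
  have hsub : ∀ E, honeycombIDS E = 1 - honeycombIDS (2 - E) := fun E => by
    rw [honeycombIDS_two_sub, sub_sub_cancel]
  refine ⟨fun E h => honeycombIDS_of_nonpos h.le, fun E h0 h1 => ?_, fun E h0 h1 => ?_,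
    fun E h0 h1 => ?_, fun E h0 h1 => ?_, fun E h => ?_, honeycombIDS_two_sub,
    not_hasEigenvalue_honeycombLaplacian⟩
  · exact ⟨(intervalIntegrable_and_quasiMomentum_real_le_blochSq h0 h1.le).1,
      honeycombIDS_lower h0 h1.le⟩
  · exact ⟨(intervalIntegrable_and_quasiMomentum_real_blochSq_le h0 h1.le).1,
      honeycombIDS_middle h0 h1.le⟩
  -- The upper half follows by reflection, the integrand depending on `E` only through `(1 - E)²`.
  -- The point `E = 1` is its own mirror image, so the closed bound `E ≤ 1` is used here.
  · have h2 := (intervalIntegrable_and_quasiMomentum_real_blochSq_le (E := 2 - E) (by linarith)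
      (by linarith)).1
    have h3 := honeycombIDS_middle (E := 2 - E) (by linarith) (by linarith)
    rw [honeycombIntegrand_two_sub, show -2 + 3 / 2 * (2 - E) = 1 - 3 / 2 * E by ring,
      show 1 - 3 / 2 * (2 - E) = -2 + 3 / 2 * E by ring] at h2 h3
    refine ⟨h2, ?_⟩
    rw [hsub, h3]
    ring
  · have h2 := (intervalIntegrable_and_quasiMomentum_real_le_blochSq (E := 2 - E) (by linarith)
      (by linarith)).1
    have h3 := honeycombIDS_lower (E := 2 - E) (by linarith) (by linarith)
    rw [honeycombIntegrand_two_sub, show 1 - 3 / 2 * (2 - E) = -2 + 3 / 2 * E by ring] at h2 h3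
    exact ⟨h2, by rw [hsub, h3]⟩
  · rw [hsub, honeycombIDS_of_nonpos (by linarith), sub_zero]
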